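/- **Setting.** Let $\mathcal X$ be a finite set and $(\mathcal X,Q,\pi)$ a Markov triple: $Q:\mathcal X\times\mathcal X\to[0,\infty)$ are transition rates with $Q(x,x)=0$, $Q$ is irreducible (any $x,y\in\mathcal X$ are joined by a path along which all rates are positive), $\pi$ is a probability measure on $\mathcal X$, and $\pi(x)Q(x,y)=\pi(y)Q(y,x)$ for all $x,y$. Let $\Lambda:[0,\infty)^2\to[0,\infty)$ be an admissible mean: continuous, $C^\infty$ on $(0,\infty)^2$, symmetric, positively $1$-homogeneous, non-decreasing in each variable, jointly concave, with $\Lambda(1,1)=1$. Let $A:\mathbb R^3\to[0,\infty]$ be the convex lower semicontinuous function $$A(s,t,w)=\begin{cases} w^2/\Lambda(s,t), & s,t\ge 0,\ \Lambda(s,t)>0,\\ 0, & s,t\ge 0,\ \Lambda(s,t)=0,\ w=0,\\ +\infty, & \text{otherwise.}\end{cases}$$ Write $\mathcal P(\mathcal X)$ for the set of probability measures on $\mathcal X$, and for $\mu\in\mathcal P(\mathcal X)$, $V:\mathcal X\times\mathcal X\to\mathbb R$ set $\mathcal A(\mu,V)=\frac12\sum_{x,y}A\big(\mu(x)Q(x,y),\mu(y)Q(y,x),V(x,y)\big)$.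 For $\mu^0,\mu^1\in\mathcal P(\mathcal X)$ let $\mathsf{CE}_1(\mu^0,\mu^1)$ be the set of pairs $(\mu_t,V_t)_{t\in[0,1]}$ such that $t\mapsto\mu_t\in\mathcal P(\mathcal X)$ is continuous on $[0,1]$, $t\mapsto V_t\in\mathbb R^{\mathcal X\times\mathcal X}$ is integrable on $[0,1]$, $\mu_0=\mu^0$, $\mu_1=\mu^1$ (values at times $t=0,1$), and $$\frac{\mathrm d}{\mathrm dt}\mu_t(x)+\frac12\sum_{y\in\mathcal X}\big(V_t(x,y)-V_t(y,x)\big)=0\qquad\text{for all }x\in\mathcal X$$ in the sense of distributions on $(0,1)$. The discrete transport distance is $$\mathcal W(\mu^0,\mu^1)=\inf\Big\{\Big(\int_0^1\mathcal A(\mu_t,V_t)\,\mathrm dt\Big)^{1/2}:(\mu,V)\in\mathsf{CE}_1(\mu^0,\mu^1)\Big\}.$$ A curve $(\mu_t)_{t\in[0,1]}$ is a minimising $\mathcal W$-geodesic from $\mu^0$ to $\mu^1$ if $\mathcal W(\mu^0,\mu^1)<\infty$, there is $V$ such that $(\mu,V)\in\mathsf{CE}_1(\mu^0,\mu^1)$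 attains this infimum, and $\mathcal W(\mu_s,\mu_t)=|t-s|\,\mathcal W(\mu^0,\mu^1)$ for all $s,t\in[0,1]$. A subset $\mathcal Y\subseteq\mathcal X$ has the retraction property if any two points of $\mathcal Y$ are joined by a path in $\mathcal Y$ along which all rates are positive, and there is a map $T:\mathcal X\to\mathcal Y$ such that $T(y)=y$ for all $y\in\mathcal Y$, and $$\sum_{x'\in T^{-1}(y')}Q(x,x')\le Q(y,y')\qquad\text{for all } y\neq y' \text{ in } \mathcal Y \text{ and all } x\in T^{-1}(y).$$ **Theorem 4.6 (weak locality under the retraction property).** Let $\mathcal Y\subseteq\mathcal X$ have the retraction property. For all $\mu^0,\mu^1\in\mathcal P(\mathcal X)$ with support in $\mathcal Y$ there exists a minimising $\mathcal W$-geodesic $(\mu_t)_{t\in[0,1]}\subseteq\mathcal P(\mathcal X)$ from $\mu^0$ to $\mu^1$ such that $\mu_t$ has support in $\mathcal Y$ for all $t\in[0,1]$. -/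

import Mathlib

open MeasureTheory Set
open scoped ENNReal ContDiff

namespace DiscreteTransport

/-- A Markov triple: irreducible transition rates `Q` on a finite set (with zero diagonal), together
with a probability vector `pi` with respect to which `Q` is reversible (hence `pi` is the stationary
probability measure). -/
structure MarkovTriple (X : Type*) [Fintype X] where
  Q : X → X → ℝ
  Q_nonneg : ∀ x y, 0 ≤ Q x y
  Q_diag : ∀ x, Q x x = 0
  irreducible : ∀ x y, Relation.ReflTransGen (fun a b => 0 < Q a b) x y
  pi : X → ℝ
  pi_mem : pi ∈ stdSimplex ℝ X
  detailed_balance : ∀ x y, pi x * Q x y = pi y * Q y x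

/-- Admissible means. Only the values of `Λ` on `[0,∞) × [0,∞)` matter. -/
structure IsAdmissibleMean (Λ : ℝ → ℝ → ℝ) : Prop where
  nonneg : ∀ s t, 0 ≤ s → 0 ≤ t → 0 ≤ Λ s t
  continuousOn : ContinuousOn (fun p : ℝ × ℝ => Λ p.1 p.2) (Ici 0 ×ˢ Ici 0)
  smooth : ContDiffOn ℝ ∞ (fun p : ℝ × ℝ => Λ p.1 p.2) (Ioi 0 ×ˢ Ioi 0)
  symm : ∀ s t, 0 ≤ s → 0 ≤ t → Λ s t = Λ t s
  homogeneous : ∀ c s t, 0 < c → 0 ≤ s → 0 ≤ t → Λ (c * s) (c * t) = c * Λ s t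
  mono_left : ∀ s s' t, 0 ≤ s → s ≤ s' → 0 ≤ t → Λ s t ≤ Λ s' t
  mono_right : ∀ s t t', 0 ≤ s → 0 ≤ t → t ≤ t' → Λ s t ≤ Λ s t'
  concave : ConcaveOn ℝ (Ici 0 ×ˢ Ici 0) (fun p : ℝ × ℝ => Λ p.1 p.2)
  normalised : Λ 1 1 = 1

/-- The convex and lower semicontinuous function `A : ℝ³ → [0,∞]`, equal to `w² / Λ(s,t)` for
`s, t ≥ 0` with `Λ(s,t) > 0` (in particular for all `s, t > 0`), equal to `0` for `w = 0` and
`s, t ≥ 0`, and equal to `∞` otherwise. The value `w² / Λ(s,t)` at boundary points with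
`Λ(s,t) > 0` is the one forced by lower semicontinuity. -/
noncomputable def edgeAction (Λ : ℝ → ℝ → ℝ) (s t w : ℝ) : ℝ≥0∞ :=
  if 0 ≤ s ∧ 0 ≤ t ∧ 0 < Λ s t then ENNReal.ofReal (w ^ 2 / Λ s t)
  else if 0 ≤ s ∧ 0 ≤ t ∧ w = 0 then 0
  else ⊤

section

variable {X : Type*} [Fintype X]

/-- The discrete divergence. -/
noncomputable def divergence (Φ : X → X → ℝ) (x : X) : ℝ :=
  (1 / 2) * ∑ y, (Φ x y - Φ y x)

/-- `(μ, V)` solves the continuity equation `dμ_t/dt + div V_t = 0` on `[0, T]` in the sense of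
distributions, with `μ` a continuous curve of probability vectors and `V` integrable on the compact
interval `[0, T]` (which is local integrability there), and `μ` runs from `μ₀` to `μ₁`.
Values at times outside `[0, T]` are irrelevant. -/
structure ContinuityEquation (T : ℝ) (μ₀ μ₁ : X → ℝ) (μ : ℝ → X → ℝ) (V : ℝ → X → X → ℝ) :
    Prop where
  continuousOn : ContinuousOn μ (Icc 0 T)
  integrableOn : ∀ x y, IntegrableOn (fun t => V t x y) (Icc 0 T) volume
  mem_simplex : ∀ t ∈ Icc 0 T, μ t ∈ stdSimplex ℝ X
  weak_eq : ∀ φ : ℝ → ℝ, ContDiff ℝ ∞ φ → HasCompactSupport φ → tsupport φ ⊆ Ioo 0 T →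
    ∀ x, ∫ t in (0 : ℝ)..T, deriv φ t * μ t x = ∫ t in (0 : ℝ)..T, φ t * divergence (V t) x
  initial : μ 0 = μ₀
  terminal : μ T = μ₁

namespace MarkovTriple

/-- The action of a momentum field `V` at `μ`. -/
noncomputable def action (M : MarkovTriple X) (Λ : ℝ → ℝ → ℝ) (μ : X → ℝ) (V : X → X → ℝ) :
    ℝ≥0∞ :=
  2⁻¹ * ∑ x, ∑ y, edgeAction Λ (μ x * M.Q x y) (μ y * M.Q y x) (V x y)

/-- The time integral over `[0, 1]` of the action along a curve. -/
noncomputable def totalAction (M : MarkovTriple X) (Λ : ℝ → ℝ → ℝ) (μ : ℝ → X → ℝ)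
    (V : ℝ → X → X → ℝ) : ℝ≥0∞ :=
  ∫⁻ t in Icc (0 : ℝ) 1, M.action Λ (μ t) (V t)

/-- The discrete transport distance. -/
noncomputable def W (M : MarkovTriple X) (Λ : ℝ → ℝ → ℝ) (μ₀ μ₁ : X → ℝ) : ℝ≥0∞ :=
  ⨅ (μ : ℝ → X → ℝ) (V : ℝ → X → X → ℝ) (_ : ContinuityEquation 1 μ₀ μ₁ μ V),
    (M.totalAction Λ μ V) ^ (1 / 2 : ℝ)

/-- `(μ_t)_{t ∈ [0,1]}` is a minimising geodesic from `μ₀` to `μ₁` for the discrete transport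
distance: the distance of the endpoints is finite, the curve, with a suitable momentum field, attains
the infimum that defines the distance, and it has constant speed. -/
structure IsMinimisingGeodesic (M : MarkovTriple X) (Λ : ℝ → ℝ → ℝ) (μ₀ μ₁ : X → ℝ)
    (μ : ℝ → X → ℝ) : Prop where
  finite : M.W Λ μ₀ μ₁ ≠ ⊤
  minimal : ∃ V : ℝ → X → X → ℝ, ContinuityEquation 1 μ₀ μ₁ μ V ∧
    (M.totalAction Λ μ V) ^ (1 / 2 : ℝ) = M.W Λ μ₀ μ₁
  constant_speed : ∀ s ∈ Icc (0 : ℝ) 1, ∀ t ∈ Icc (0 : ℝ) 1,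
    M.W Λ (μ s) (μ t) = ENNReal.ofReal |t - s| * M.W Λ μ₀ μ₁

/-- Any two points of `Y` are joined by a path inside `Y` with positive rates. -/
def IsConnectedSubset (M : MarkovTriple X) (Y : Set X) : Prop :=
  ∀ y ∈ Y, ∀ y' ∈ Y, Relation.ReflTransGen (fun a b => a ∈ Y ∧ b ∈ Y ∧ 0 < M.Q a b) y y'

/-- `T` is a retraction of the state space onto `Y`. -/
structure IsRetraction [DecidableEq X] (M : MarkovTriple X) (Y : Set X) (T : X → X) : Prop where
  mapsTo : ∀ x, T x ∈ Y
  fixes : ∀ y ∈ Y, T y = y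
  rate_le : ∀ y ∈ Y, ∀ y' ∈ Y, y ≠ y' → ∀ x, T x = y →
    ∑ x' with T x' = y', M.Q x x' ≤ M.Q y y'

/-- The retraction property of a (connected) subset. -/
def HasRetractionProperty [DecidableEq X] (M : MarkovTriple X) (Y : Set X) : Prop :=
  M.IsConnectedSubset Y ∧ ∃ T : X → X, M.IsRetraction Y T

end MarkovTriple

end

end DiscreteTransport

/-! Push a minimiser forward along the retraction `T`. Push-forward sends curves to curves supported
in $\mathcal Y$, fixes endpoints already supported there, and preserves the continuity equation once
momenta are summed over pairs of fibres (`divergence_pushMomentum`). The action does not increase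
(`action_push_le`): the edge action is subadditive and antitone in the two densities
(`edgeAction_sum_le`), and the rate inequality says exactly that the mass flux summed over two
fibres is at most the flux of the pushed density. So the pushed curve is again a minimiser.

It remains to see that minimisers exist and are constant-speed geodesics. Existence
(`exists_minimiser`) is the direct method in $L^2$ of momenta: the action is jointly convex and
lower semicontinuous and controls the $L^2$ norm, the curve is an affine function of the momentum,
and a finite competitor is obtained by mixing in a little of $\pi$ at intermediate times. For
constant speed (`sqrt_cost_eq_of_minimal`), the pieces of a minimiser on $[0,s]$, $[s,t]$, $[t,1]$
are rescaled to competitors, and the triangle inequality forces equality in Cauchy-Schwarz on each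
piece.

Both halves use the continuity equation in integrated form, which is equivalent to the
distributional one (`continuityEquation_iff`). -/

namespace DiscreteTransport

/-! ### Admissible means and the edge action -/

section Mean

variable {Λ : ℝ → ℝ → ℝ}

namespace IsAdmissibleMean

theorem apply_self (hΛ : IsAdmissibleMean Λ) {m : ℝ} (hm : 0 < m) : Λ m m = m := by
  have := hΛ.homogeneous m 1 1 hm zero_le_one zero_le_one
  simpa [hΛ.normalised] using this

theorem le_of_le (hΛ : IsAdmissibleMean Λ) {s t m : ℝ} (hs : 0 ≤ s) (ht : 0 ≤ t) (hm : 0 < m)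
    (hsm : s ≤ m) (htm : t ≤ m) : Λ s t ≤ m :=
  (hΛ.mono_left s m t hs hsm ht).trans
    ((hΛ.mono_right m t m hm.le ht htm).trans (hΛ.apply_self hm).le)

theorem le_apply (hΛ : IsAdmissibleMean Λ) {s t m : ℝ} (hm : 0 < m) (hsm : m ≤ s) (htm : m ≤ t) :
    m ≤ Λ s t :=
  (hΛ.apply_self hm).ge.trans ((hΛ.mono_left m s m hm.le hsm hm.le).trans
    (hΛ.mono_right s m t (hm.le.trans hsm) hm.le htm))

/-- Concavity at the midpoint, with the factor 1/2 removed by homogeneity. -/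
theorem add_le (hΛ : IsAdmissibleMean Λ) {s t s' t' : ℝ} (hs : 0 ≤ s) (ht : 0 ≤ t) (hs' : 0 ≤ s')
    (ht' : 0 ≤ t') : Λ s t + Λ s' t' ≤ Λ (s + s') (t + t') := by
  have h := hΛ.concave.2 (show (s, t) ∈ Ici 0 ×ˢ Ici 0 from ⟨hs, ht⟩)
    (show (s', t') ∈ Ici 0 ×ˢ Ici 0 from ⟨hs', ht'⟩)
    (show (0 : ℝ) ≤ 1 / 2 by norm_num) (show (0 : ℝ) ≤ 1 / 2 by norm_num) (by norm_num)
  have h2 := hΛ.homogeneous (1 / 2) (s + s') (t + t') (by norm_num) (by positivity) (by positivity)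
  simp only [smul_eq_mul, Prod.smul_mk, Prod.mk_add_mk, ← mul_add] at h
  linarith

theorem sum_le {ι : Type*} (hΛ : IsAdmissibleMean Λ) (I : Finset ι) (s t : ι → ℝ)
    (hs : ∀ i, 0 ≤ s i) (ht : ∀ i, 0 ≤ t i) :
    ∑ i ∈ I, Λ (s i) (t i) ≤ Λ (∑ i ∈ I, s i) (∑ i ∈ I, t i) := by
  classical
  induction I using Finset.induction_on with
  | empty => simpa using hΛ.nonneg 0 0 le_rfl le_rfl
  | insert i I hi ih =>
    rw [Finset.sum_insert hi, Finset.sum_insert hi, Finset.sum_insert hi]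
    exact (by gcongr : _ ≤ _).trans (hΛ.add_le (hs i) (ht i) (Finset.sum_nonneg fun i _ => hs i)
      (Finset.sum_nonneg fun i _ => ht i))

/-- Truncation at zero gives a continuous function on the whole plane, so that the action extends to
signed densities and semicontinuity can be used without side conditions. -/
theorem continuous_max (hΛ : IsAdmissibleMean Λ) :
    Continuous (fun p : ℝ × ℝ => Λ (max p.1 0) (max p.2 0)) :=
  hΛ.continuousOn.comp_continuous (f := fun p : ℝ × ℝ => (max p.1 0, max p.2 0)) (by fun_prop)
    fun p => ⟨mem_Ici.2 (le_max_right _ _), mem_Ici.2 (le_max_right _ _)⟩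

/-- Legendre duality in `w`. One formula covers all branches of the definition on the quadrant; for
fixed `a` the expression is continuous, convex in `(s, t, w)` and antitone in `s, t`, and these
properties pass to the supremum. -/
theorem edgeAction_eq_iSup (hΛ : IsAdmissibleMean Λ) {s t : ℝ} (hs : 0 ≤ s) (ht : 0 ≤ t) (w : ℝ) :
    edgeAction Λ s t w = ⨆ a : ℝ, ENNReal.ofReal (2 * a * w - a ^ 2 * Λ s t) := by
  unfold edgeAction
  rcases (hΛ.nonneg s t hs ht).lt_or_eq with h | h
  · rw [if_pos ⟨hs, ht, h⟩]
    apply le_antisymm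
    · refine le_iSup_of_le (w / Λ s t) (ENNReal.ofReal_le_ofReal (le_of_eq ?_))
      field_simp
      ring
    · refine iSup_le fun a => ENNReal.ofReal_le_ofReal ?_
      rw [le_div_iff₀ h]
      nlinarith [sq_nonneg (w - a * Λ s t)]
  · rw [if_neg (by simp [← h]), ← h]
    by_cases hw : w = 0
    · simp [hw, hs, ht]
    · rw [if_neg (by simp [hw]), eq_comm, iSup_eq_top]
      intro b hb
      -- With `Λ s t = 0` the expression is linear in `a` with slope `2 * w ≠ 0`; this `a` gives it
      -- the value `b + 1`.
      refine ⟨(b.toReal + 1) / (2 * w), ?_⟩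
      rw [ENNReal.lt_ofReal_iff_toReal_lt hb.ne]
      have : 2 * ((b.toReal + 1) / (2 * w)) * w - ((b.toReal + 1) / (2 * w)) ^ 2 * 0 =
          b.toReal + 1 := by
        field_simp
        ring
      linarith

theorem ofReal_le_edgeAction (hΛ : IsAdmissibleMean Λ) {s t : ℝ} (hs : 0 ≤ s) (ht : 0 ≤ t)
    {K : ℝ} (hK : 0 < K) (h : Λ s t ≤ K) (w : ℝ) :
    ENNReal.ofReal (w ^ 2 / K) ≤ edgeAction Λ s t w := by
  rw [hΛ.edgeAction_eq_iSup hs ht]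
  refine le_iSup_of_le (w / K) (ENNReal.ofReal_le_ofReal ?_)
  have : (w / K) ^ 2 * Λ s t ≤ (w / K) ^ 2 * K := by gcongr
  have h2 : 2 * (w / K) * w - (w / K) ^ 2 * K = w ^ 2 / K := by
    field_simp
    ring
  linarith

theorem edgeAction_le_ofReal (hΛ : IsAdmissibleMean Λ) {s t : ℝ} {m : ℝ} (hm : 0 < m) (hs : m ≤ s)
    (ht : m ≤ t) (w : ℝ) : edgeAction Λ s t w ≤ ENNReal.ofReal (w ^ 2 / m) := by
  have h := hΛ.le_apply hm hs ht
  rw [edgeAction, if_pos ⟨hm.le.trans hs, hm.le.trans ht, hm.trans_le h⟩]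
  gcongr

theorem edgeAction_zero (hΛ : IsAdmissibleMean Λ) {s t : ℝ} (hs : 0 ≤ s) (ht : 0 ≤ t) :
    edgeAction Λ s t 0 = 0 := by
  rw [hΛ.edgeAction_eq_iSup hs ht, ENNReal.iSup_eq_zero]
  intro a
  have := hΛ.nonneg s t hs ht
  rw [ENNReal.ofReal_eq_zero]
  nlinarith [mul_nonneg (sq_nonneg a) this]

theorem edgeAction_mul (hΛ : IsAdmissibleMean Λ) {s t : ℝ} (hs : 0 ≤ s) (ht : 0 ≤ t) (c w : ℝ) :
    edgeAction Λ s t (c * w) = ENNReal.ofReal (c ^ 2) * edgeAction Λ s t w := by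
  -- The case `c = 0` relies on the convention `0 * ⊤ = 0`.
  rcases eq_or_ne c 0 with rfl | hc
  · simp [hΛ.edgeAction_zero hs ht]
  unfold edgeAction
  split_ifs with h1 h2 h3 h4
  · rw [← ENNReal.ofReal_mul (sq_nonneg c)]
    congr 1
    ring
  · simp
  · simp_all
  · simp_all
  · rw [ENNReal.mul_top]
    simpa using by positivity

theorem edgeAction_convex (hΛ : IsAdmissibleMean Λ) {s t s' t' a b : ℝ} (hs : 0 ≤ s) (ht : 0 ≤ t)
    (hs' : 0 ≤ s') (ht' : 0 ≤ t') (ha : 0 ≤ a) (hb : 0 ≤ b) (hab : a + b = 1) (w w' : ℝ) :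
    edgeAction Λ (a * s + b * s') (a * t + b * t') (a * w + b * w') ≤
      ENNReal.ofReal a * edgeAction Λ s t w + ENNReal.ofReal b * edgeAction Λ s' t' w' := by
  rw [hΛ.edgeAction_eq_iSup (by positivity) (by positivity)]
  refine iSup_le fun c => ?_
  have h := hΛ.concave.2 (show (s, t) ∈ Ici 0 ×ˢ Ici 0 from ⟨hs, ht⟩)
    (show (s', t') ∈ Ici 0 ×ˢ Ici 0 from ⟨hs', ht'⟩) ha hb hab
  simp only [smul_eq_mul, Prod.smul_mk, Prod.mk_add_mk] at h
  calc ENNReal.ofReal (2 * c * (a * w + b * w') - c ^ 2 * Λ (a * s + b * s') (a * t + b * t'))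
      ≤ ENNReal.ofReal (a * (2 * c * w - c ^ 2 * Λ s t) + b * (2 * c * w' - c ^ 2 * Λ s' t')) := by
        refine ENNReal.ofReal_le_ofReal ?_
        nlinarith [mul_le_mul_of_nonneg_left h (sq_nonneg c)]
    _ ≤ ENNReal.ofReal a * ENNReal.ofReal (2 * c * w - c ^ 2 * Λ s t) +
        ENNReal.ofReal b * ENNReal.ofReal (2 * c * w' - c ^ 2 * Λ s' t') := by
        rw [← ENNReal.ofReal_mul ha, ← ENNReal.ofReal_mul hb]
        exact ENNReal.ofReal_add_le
    _ ≤ _ := by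
        rw [hΛ.edgeAction_eq_iSup hs ht, hΛ.edgeAction_eq_iSup hs' ht']
        gcongr
        · exact le_iSup (fun c => ENNReal.ofReal (2 * c * w - c ^ 2 * Λ s t)) c
        · exact le_iSup (fun c => ENNReal.ofReal (2 * c * w' - c ^ 2 * Λ s' t')) c

/-- The edge action is subadditive, and antitone in its first two arguments. -/
theorem edgeAction_sum_le {ι : Type*} (hΛ : IsAdmissibleMean Λ) (I : Finset ι) (s t w : ι → ℝ)
    (hs : ∀ i, 0 ≤ s i) (ht : ∀ i, 0 ≤ t i) {s' t' : ℝ} (hs' : ∑ i ∈ I, s i ≤ s')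
    (ht' : ∑ i ∈ I, t i ≤ t') :
    edgeAction Λ s' t' (∑ i ∈ I, w i) ≤ ∑ i ∈ I, edgeAction Λ (s i) (t i) (w i) := by
  have hs0 : 0 ≤ ∑ i ∈ I, s i := Finset.sum_nonneg fun i _ => hs i
  have ht0 : 0 ≤ ∑ i ∈ I, t i := Finset.sum_nonneg fun i _ => ht i
  rw [hΛ.edgeAction_eq_iSup (hs0.trans hs') (ht0.trans ht')]
  refine iSup_le fun c => ?_
  -- Superadditivity, then monotonicity, of the mean; it makes each dual expression subadditive.
  have h : ∑ i ∈ I, Λ (s i) (t i) ≤ Λ s' t' :=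
    (hΛ.sum_le I s t hs ht).trans ((hΛ.mono_left _ _ _ hs0 hs' ht0).trans
      (hΛ.mono_right _ _ _ (hs0.trans hs') ht0 ht'))
  calc ENNReal.ofReal (2 * c * ∑ i ∈ I, w i - c ^ 2 * Λ s' t')
      ≤ ENNReal.ofReal (∑ i ∈ I, (2 * c * w i - c ^ 2 * Λ (s i) (t i))) := by
        refine ENNReal.ofReal_le_ofReal ?_
        rw [Finset.sum_sub_distrib, ← Finset.mul_sum, ← Finset.mul_sum]
        gcongr
    _ ≤ ∑ i ∈ I, ENNReal.ofReal (2 * c * w i - c ^ 2 * Λ (s i) (t i)) :=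
        Finset.le_sum_of_subadditive _ (by simp) (fun _ _ => ENNReal.ofReal_add_le) _ _
    _ ≤ _ := by
        refine Finset.sum_le_sum fun i _ => ?_
        rw [hΛ.edgeAction_eq_iSup (hs i) (ht i)]
        exact le_iSup (fun c => ENNReal.ofReal (2 * c * w i - c ^ 2 * Λ (s i) (t i))) c

end IsAdmissibleMean

end Mean

/-! ### The action as a convex, lower semicontinuous functional -/

section Action

variable {X : Type*} [Fintype X] {Λ : ℝ → ℝ → ℝ}

namespace MarkovTriple

/-- A lower semicontinuous extension of the action to signed densities. -/
noncomputable def extendedAction (M : MarkovTriple X) (Λ : ℝ → ℝ → ℝ)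
    (p : (X → ℝ) × (X → X → ℝ)) : ℝ≥0∞ :=
  2⁻¹ * ∑ x, ∑ y, ⨆ a : ℝ, ENNReal.ofReal (2 * a * p.2 x y -
    a ^ 2 * Λ (max (p.1 x * M.Q x y) 0) (max (p.1 y * M.Q y x) 0))

theorem action_eq_extendedAction (M : MarkovTriple X) (hΛ : IsAdmissibleMean Λ) {μ : X → ℝ}
    (hμ : 0 ≤ μ) (V : X → X → ℝ) : M.action Λ μ V = M.extendedAction Λ (μ, V) := by
  unfold action extendedAction
  congr 1
  refine Finset.sum_congr rfl fun x _ => Finset.sum_congr rfl fun y _ => ?_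
  have h1 := mul_nonneg (hμ x) (M.Q_nonneg x y)
  have h2 := mul_nonneg (hμ y) (M.Q_nonneg y x)
  rw [hΛ.edgeAction_eq_iSup h1 h2]
  simp only [max_eq_left h1, max_eq_left h2]

theorem lowerSemicontinuous_extendedAction (M : MarkovTriple X) (hΛ : IsAdmissibleMean Λ) :
    LowerSemicontinuous (M.extendedAction Λ) := by
  unfold extendedAction
  refine (ENNReal.continuous_const_mul (by simp)).comp_lowerSemicontinuous ?_
    (fun a b h => mul_le_mul_right h _)
  refine lowerSemicontinuous_sum fun x _ => lowerSemicontinuous_sum fun y _ =>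
    lowerSemicontinuous_iSup fun a => Continuous.lowerSemicontinuous ?_
  have := hΛ.continuous_max.comp (f := fun p : (X → ℝ) × (X → X → ℝ) =>
    (p.1 x * M.Q x y, p.1 y * M.Q y x)) (by fun_prop)
  simp only [Function.comp_def] at this
  exact ENNReal.continuous_ofReal.comp
    ((by fun_prop : Continuous fun p : (X → ℝ) × (X → X → ℝ) => 2 * a * p.2 x y).sub
      (continuous_const.mul this))

theorem measurable_extendedAction (M : MarkovTriple X) (hΛ : IsAdmissibleMean Λ) :
    Measurable (M.extendedAction Λ) :=
  (M.lowerSemicontinuous_extendedAction hΛ).measurable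

theorem action_smul (M : MarkovTriple X) (hΛ : IsAdmissibleMean Λ) {μ : X → ℝ}
    (hμ : 0 ≤ μ) (c : ℝ) (V : X → X → ℝ) :
    M.action Λ μ (c • V) = ENNReal.ofReal (c ^ 2) * M.action Λ μ V := by
  unfold action
  simp only [Pi.smul_apply, smul_eq_mul]
  rw [mul_left_comm]
  congr 1
  rw [Finset.mul_sum]
  refine Finset.sum_congr rfl fun x _ => ?_
  rw [Finset.mul_sum]
  exact Finset.sum_congr rfl fun y _ => hΛ.edgeAction_mul
    (mul_nonneg (hμ x) (M.Q_nonneg x y)) (mul_nonneg (hμ y) (M.Q_nonneg y x)) _ _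

theorem action_convex (M : MarkovTriple X) (hΛ : IsAdmissibleMean Λ) {μ ν : X → ℝ}
    (hμ : 0 ≤ μ) (hν : 0 ≤ ν) {a b : ℝ} (ha : 0 ≤ a) (hb : 0 ≤ b) (hab : a + b = 1)
    (V U : X → X → ℝ) :
    M.action Λ (a • μ + b • ν) (a • V + b • U) ≤
      ENNReal.ofReal a * M.action Λ μ V + ENNReal.ofReal b * M.action Λ ν U := by
  unfold action
  rw [mul_left_comm, mul_left_comm (ENNReal.ofReal b), ← mul_add]
  gcongr
  rw [Finset.mul_sum, Finset.mul_sum, ← Finset.sum_add_distrib]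
  gcongr with x
  rw [Finset.mul_sum, Finset.mul_sum, ← Finset.sum_add_distrib]
  gcongr with y
  have := hΛ.edgeAction_convex (mul_nonneg (hμ x) (M.Q_nonneg x y))
    (mul_nonneg (hμ y) (M.Q_nonneg y x)) (mul_nonneg (hν x) (M.Q_nonneg x y))
    (mul_nonneg (hν y) (M.Q_nonneg y x)) ha hb hab (V x y) (U x y)
  simpa only [Pi.add_apply, Pi.smul_apply, smul_eq_mul, add_mul, mul_assoc] using this

/-- On probability vectors the action dominates the squared Euclidean norm of the momentum. -/
theorem exists_sum_sq_le_action (M : MarkovTriple X) (hΛ : IsAdmissibleMean Λ) :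
    ∃ C : ℝ, 0 < C ∧ ∀ μ ∈ stdSimplex ℝ X, ∀ V : X → X → ℝ,
      ENNReal.ofReal (∑ x, ∑ y, V x y ^ 2) ≤ ENNReal.ofReal C * M.action Λ μ V := by
  -- `K` bounds every rate, hence every flux of a probability vector and every mean of two fluxes;
  -- the 1 keeps it positive when all rates vanish.
  set K : ℝ := 1 + ∑ x, ∑ y, M.Q x y with hK
  have hQK : ∀ x y, M.Q x y ≤ K := by
    intro x y
    have h1 : M.Q x y ≤ ∑ y, M.Q x y :=
      Finset.single_le_sum (fun y _ => M.Q_nonneg x y) (Finset.mem_univ y)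
    have h2 : ∑ y, M.Q x y ≤ ∑ x, ∑ y, M.Q x y :=
      Finset.single_le_sum (f := fun x => ∑ y, M.Q x y)
        (fun x _ => Finset.sum_nonneg fun y _ => M.Q_nonneg x y) (Finset.mem_univ x)
    linarith
  have hK0 : 0 < K := by
    have : 0 ≤ ∑ x, ∑ y, M.Q x y :=
      Finset.sum_nonneg fun x _ => Finset.sum_nonneg fun y _ => M.Q_nonneg x y
    linarith
  refine ⟨2 * K, by positivity, fun μ hμ V => ?_⟩
  have hμQ : ∀ x y, μ x * M.Q x y ≤ K := fun x y =>
    (mul_le_of_le_one_left (M.Q_nonneg x y) (mem_Icc_of_mem_stdSimplex hμ x).2).trans (hQK x y)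
  have h : ENNReal.ofReal ((∑ x, ∑ y, V x y ^ 2) / K) ≤
      ∑ x, ∑ y, edgeAction Λ (μ x * M.Q x y) (μ y * M.Q y x) (V x y) := by
    rw [Finset.sum_div, ENNReal.ofReal_sum_of_nonneg
      (fun x _ => div_nonneg (Finset.sum_nonneg fun y _ => sq_nonneg _) hK0.le)]
    refine Finset.sum_le_sum fun x _ => ?_
    rw [Finset.sum_div, ENNReal.ofReal_sum_of_nonneg (fun y _ => by positivity)]
    refine Finset.sum_le_sum fun y _ => ?_
    have h1 := mul_nonneg (hμ.1 x) (M.Q_nonneg x y)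
    have h2 := mul_nonneg (hμ.1 y) (M.Q_nonneg y x)
    exact hΛ.ofReal_le_edgeAction h1 h2 hK0 (hΛ.le_of_le h1 h2 hK0 (hμQ x y) (hμQ y x)) _
  have e : ENNReal.ofReal (∑ x, ∑ y, V x y ^ 2) =
      ENNReal.ofReal (2 * K) * (2⁻¹ * ENNReal.ofReal ((∑ x, ∑ y, V x y ^ 2) / K)) := by
    have : (2⁻¹ : ℝ≥0∞) = ENNReal.ofReal 2⁻¹ := by
      rw [ENNReal.ofReal_inv_of_pos (by norm_num)]
      simp
    rw [this, ← ENNReal.ofReal_mul (by norm_num), ← ENNReal.ofReal_mul (by positivity)]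
    congr 1
    field_simp
  rw [e]
  unfold action
  gcongr

end MarkovTriple

end Action

/-! ### Distributional derivatives and integration by parts -/

section DuBoisReymond

/-- **du Bois-Reymond lemma**: a continuous function whose distributional derivative vanishes is
constant. -/
theorem eq_left_of_integral_deriv_mul_eq_zero {a b : ℝ} (hab : a < b) {f : ℝ → ℝ}
    (hf : ContinuousOn f (Icc a b))
    (h : ∀ φ : ℝ → ℝ, ContDiff ℝ ∞ φ → HasCompactSupport φ → tsupport φ ⊆ Ioo a b →
      ∫ t in a..b, deriv φ t * f t = 0) {t : ℝ} (ht : t ∈ Icc a b) : f t = f a := by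
  let B : ContDiffBump ((a + b) / 2) := ⟨(b - a) / 8, (b - a) / 4, by linarith, by linarith⟩
  set ψ : ℝ → ℝ := B.normed volume with hψ
  have hψs : ContDiff ℝ ∞ ψ := B.contDiff_normed
  have hψt : tsupport ψ = Icc ((a + b) / 2 - (b - a) / 4) ((a + b) / 2 + (b - a) / 4) := by
    rw [hψ, B.tsupport_normed_eq, Real.closedBall_eq_Icc]
  have hψ1 : ∫ t in a..b, ψ t = 1 := by
    rw [intervalIntegral.integral_eq_integral_of_support_subset, B.integral_normed]
    refine (subset_tsupport _).trans (hψt.trans_subset fun x hx => ?_)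
    exact ⟨by linarith [hx.1], by linarith [hx.2]⟩
  set C : ℝ := ∫ t in a..b, ψ t * f t with hC
  have hfi : IntervalIntegrable f volume a b := hf.intervalIntegrable_of_Icc hab.le
  have key : ∀ g : ℝ → ℝ, ContDiff ℝ ∞ g → HasCompactSupport g → tsupport g ⊆ Ioo a b →
      ∫ t, g t • (f t - C) = 0 := by
    intro g hg hgc hgt
    have hgcont := hg.continuous
    have hψcont := hψs.continuous
    set I : ℝ := ∫ t in a..b, g t with hI
    -- Subtracting a multiple of the unit-mass bump makes the integral vanish, so the primitive of
    -- `k` is compactly supported in `(a, b)` and is a legitimate test function.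
    set k : ℝ → ℝ := fun t => g t - I * ψ t with hk
    have hks : ContDiff ℝ ∞ k := hg.sub (contDiff_const.mul hψs)
    have hkc : Continuous k := hks.continuous
    obtain ⟨c, d, hac, hcd, hdb, hkcd⟩ : ∃ c d, a < c ∧ c ≤ d ∧ d < b ∧ ∀ t ∉ Icc c d, k t = 0 := by
      have hKc : IsCompact (tsupport g ∪ tsupport ψ) :=
        hgc.isCompact.union (hψt ▸ isCompact_Icc)
      have hKs : tsupport g ∪ tsupport ψ ⊆ Ioo a b := by
        refine union_subset hgt (hψt.trans_subset fun x hx => ?_)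
        exact ⟨by linarith [hx.1], by linarith [hx.2]⟩
      have hKn : (tsupport g ∪ tsupport ψ).Nonempty :=
        ⟨(a + b) / 2, Or.inr (hψt ▸ ⟨by linarith, by linarith⟩)⟩
      obtain ⟨c, hc⟩ := hKc.exists_isLeast hKn
      obtain ⟨d, hd⟩ := hKc.exists_isGreatest hKn
      refine ⟨c, d, (hKs hc.1).1, hc.2 hd.1, (hKs hd.1).2, fun t ht => ?_⟩
      have h1 : t ∉ tsupport g ∪ tsupport ψ := fun h => ht ⟨hc.2 h, hd.2 h⟩
      rw [mem_union, not_or] at h1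
      simp [hk, image_eq_zero_of_notMem_tsupport h1.1, image_eq_zero_of_notMem_tsupport h1.2]
    set Φ : ℝ → ℝ := fun t => ∫ s in a..t, k s with hΦ
    have hΦd : ∀ t, HasDerivAt Φ (k t) t := fun t => hkc.integral_hasStrictDerivAt a t |>.hasDerivAt
    have hΦ' : deriv Φ = k := funext fun t => (hΦd t).deriv
    have hΦs : ContDiff ℝ ∞ Φ :=
      contDiff_infty_iff_deriv.2 ⟨fun t => (hΦd t).differentiableAt, hΦ' ▸ hks⟩
    have hkab : ∫ t in a..b, k t = 0 := by
      rw [hk, intervalIntegral.integral_sub (hgcont.intervalIntegrable _ _)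
        ((hψcont.const_mul I).intervalIntegrable _ _), intervalIntegral.integral_const_mul, hψ1]
      simp [hI]
    have hΦ0 : ∀ t ∉ Icc c d, Φ t = 0 := by
      intro t ht
      rcases lt_or_ge t c with htc | htc
      · refine (intervalIntegral.integral_congr (g := fun _ => (0 : ℝ)) fun s hs => ?_).trans
          (by simp)
        refine hkcd s fun hs' => ?_
        have h3 : s < c := hs.2.trans_lt (max_lt hac htc)
        exact absurd hs'.1 (not_le.2 h3)
      · have hdt : d < t := by
          by_contra h'
          exact ht ⟨htc, not_lt.1 h'⟩
        have h1 : ∫ s in t..b, k s = 0 := by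
          refine (intervalIntegral.integral_congr (g := fun _ => (0 : ℝ)) fun s hs => ?_).trans
            (by simp)
          refine hkcd s fun hs' => ?_
          have h3 : d < s := (lt_min hdt hdb).trans_le hs.1
          exact absurd hs'.2 (not_le.2 h3)
        have h2 := intervalIntegral.integral_add_adjacent_intervals
          (hkc.intervalIntegrable (μ := volume) a t) (hkc.intervalIntegrable t b)
        simp only [hΦ]
        linarith
    have hΦt : tsupport Φ ⊆ Icc c d :=
      closure_minimal (fun t ht => by_contra fun h' => ht (hΦ0 t h')) isClosed_Icc
    have hz := h Φ hΦs (isCompact_Icc.of_isClosed_subset (isClosed_tsupport _) hΦt)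
      (hΦt.trans fun x hx => ⟨hac.trans_le hx.1, hx.2.trans_lt hdb⟩)
    have h1 : ∫ t in a..b, g t * f t = I * C := by
      have e : ∀ t, deriv Φ t * f t = g t * f t - I * (ψ t * f t) := fun t => by
        rw [hΦ', hk]
        ring
      simp only [e] at hz
      rw [intervalIntegral.integral_sub (hfi.continuousOn_mul hgcont.continuousOn)
        ((hfi.continuousOn_mul hψcont.continuousOn).const_mul I),
        intervalIntegral.integral_const_mul] at hz
      linarith
    calc ∫ t, g t • (f t - C) = ∫ t in a..b, g t • (f t - C) := by
          rw [intervalIntegral.integral_eq_integral_of_support_subset]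
          refine (Function.support_smul_subset_left _ _).trans ((subset_tsupport _).trans
            (hgt.trans Ioo_subset_Ioc_self))
      _ = (∫ t in a..b, g t * f t) - ∫ t in a..b, g t * C := by
          simp only [smul_eq_mul, mul_sub]
          exact intervalIntegral.integral_sub (hfi.continuousOn_mul hgcont.continuousOn)
            ((hgcont.mul continuous_const).intervalIntegrable _ _)
      _ = 0 := by
          rw [h1, intervalIntegral.integral_mul_const]
          simp [hI]
  have hae := isOpen_Ioo.ae_eq_zero_of_integral_contDiff_smul_eq_zero (μ := volume)
    (f := fun t => f t - C) (U := Ioo a b)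
    (((hf.mono Ioo_subset_Icc_self).sub continuousOn_const).locallyIntegrableOn
      measurableSet_Ioo) key
  have heq : f =ᵐ[volume.restrict (Icc a b)] fun _ => C := by
    rw [← Measure.restrict_congr_set (Ioo_ae_eq_Icc (a := a) (b := b))]
    rw [Filter.EventuallyEq, ae_restrict_iff' measurableSet_Ioo]
    filter_upwards [hae] with x hx hx'
    linarith [hx hx']
  have hE := Measure.eqOn_Icc_of_ae_eq volume hab.ne heq hf continuousOn_const
  rw [hE ht, hE (left_mem_Icc.2 hab.le)]

/-- Both boundary terms vanish: the primitive is zero at `a` and `φ` is zero at `b`. Absolute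
continuity suffices for the integration by parts. -/
theorem integral_deriv_mul_primitive {a b : ℝ} {φ g : ℝ → ℝ} (hφ : ContDiff ℝ ∞ φ)
    (hb : φ b = 0) (hg : IntervalIntegrable g volume a b) :
    ∫ t in a..b, deriv φ t * ∫ s in a..t, g s = -∫ t in a..b, φ t * g t := by
  have h1 : AbsolutelyContinuousOnInterval φ a b :=
    (hφ.of_le (by exact_mod_cast le_top)).contDiffOn.absolutelyContinuousOnInterval
  have h2 := hg.absolutelyContinuousOnInterval_intervalIntegral (c := a) left_mem_uIcc
  have h3 := h1.integral_mul_deriv_eq_deriv_mul h2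
  rw [hb, intervalIntegral.integral_same] at h3
  have h4 : ∫ t in a..b, φ t * g t = ∫ t in a..b, φ t * deriv (fun t => ∫ s in a..t, g s) t := by
    refine intervalIntegral.integral_congr_ae ?_
    filter_upwards [hg.ae_hasDerivAt_integral] with t ht ht'
    rw [(ht (uIoc_subset_uIcc ht') a left_mem_uIcc).deriv]
  linarith

end DuBoisReymond

/-! ### The continuity equation in integrated form -/

section

variable {X : Type*} [Fintype X]

/-- The continuity equation on `[0, 1]` in integrated form. -/
structure IntegralSolution (μ₀ μ₁ : X → ℝ) (μ : ℝ → X → ℝ) (V : ℝ → X → X → ℝ) : Prop where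
  integrableOn : ∀ x y, IntegrableOn (fun t => V t x y) (Icc 0 1) volume
  mem_simplex : ∀ t ∈ Icc (0 : ℝ) 1, μ t ∈ stdSimplex ℝ X
  eq_sub_integral : ∀ t ∈ Icc (0 : ℝ) 1, ∀ x, μ t x = μ₀ x - ∫ s in (0 : ℝ)..t, divergence (V s) x
  terminal : μ 1 = μ₁

theorem intervalIntegrable_divergence {V : ℝ → X → X → ℝ}
    (hV : ∀ x y, IntegrableOn (fun t => V t x y) (Icc 0 1) volume) (x : X) {s t : ℝ}
    (hs : s ∈ Icc (0 : ℝ) 1) (ht : t ∈ Icc (0 : ℝ) 1) :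
    IntervalIntegrable (fun t => divergence (V t) x) volume s t := by
  have h : IntegrableOn (fun t => divergence (V t) x) (Icc 0 1) volume := by
    unfold divergence
    exact (integrable_finsetSum _ fun y _ => (hV x y).sub (hV y x)).const_mul _
  refine (h.mono_set ?_).intervalIntegrable
  exact uIcc_subset_Icc hs ht

theorem continuousOn_primitive_divergence {V : ℝ → X → X → ℝ}
    (hV : ∀ x y, IntegrableOn (fun t => V t x y) (Icc 0 1) volume) (x : X) :
    ContinuousOn (fun t => ∫ s in (0 : ℝ)..t, divergence (V s) x) (Icc 0 1) := by
  have := (intervalIntegrable_divergence hV x (s := 0) (t := 1) (by simp)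
    (by simp)).absolutelyContinuousOnInterval_intervalIntegral (c := 0) left_mem_uIcc
  simpa using this.continuousOn

theorem IntegralSolution.initial {μ₀ μ₁ : X → ℝ} {μ : ℝ → X → ℝ} {V : ℝ → X → X → ℝ}
    (h : IntegralSolution μ₀ μ₁ μ V) : μ 0 = μ₀ :=
  funext fun x => by simpa using h.eq_sub_integral 0 (by simp) x

theorem IntegralSolution.continuousOn {μ₀ μ₁ : X → ℝ} {μ : ℝ → X → ℝ} {V : ℝ → X → X → ℝ}
    (h : IntegralSolution μ₀ μ₁ μ V) : ContinuousOn μ (Icc 0 1) := by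
  refine continuousOn_pi.2 fun x => ContinuousOn.congr ?_ fun t ht => h.eq_sub_integral t ht x
  exact continuousOn_const.sub <| continuousOn_primitive_divergence h.integrableOn x

/-- In one direction, the curve plus the primitive of the divergence has vanishing distributional
derivative and is therefore constant; the other is integration by parts. -/
theorem continuityEquation_iff {μ₀ μ₁ : X → ℝ} {μ : ℝ → X → ℝ} {V : ℝ → X → X → ℝ} :
    ContinuityEquation 1 μ₀ μ₁ μ V ↔ IntegralSolution μ₀ μ₁ μ V := by
  constructor
  · intro h
    refine ⟨h.integrableOn, h.mem_simplex, fun t ht x => ?_, h.terminal⟩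
    have hg := intervalIntegrable_divergence h.integrableOn x (s := 0) (t := 1) (by simp) (by simp)
    have hμc : ContinuousOn (fun t => μ t x) (Icc 0 1) := continuousOn_pi.1 h.continuousOn x
    have hGc := continuousOn_primitive_divergence h.integrableOn x
    have := eq_left_of_integral_deriv_mul_eq_zero zero_lt_one (hμc.add hGc) (fun φ hφ hφc hφt => ?_)
      ht
    · simp only [Pi.add_apply, intervalIntegral.integral_same, h.initial] at this
      linarith
    · have hφ' : Continuous (deriv φ) := hφ.continuous_deriv (by exact_mod_cast le_top)
      have h1 : φ 1 = 0 := image_eq_zero_of_notMem_tsupport fun h => by simpa using (hφt h).2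
      simp only [Pi.add_apply, mul_add]
      rw [intervalIntegral.integral_add (f := fun t => deriv φ t * μ t x)
        (g := fun t => deriv φ t * ∫ s in (0 : ℝ)..t, divergence (V s) x)
        ((hφ'.continuousOn.mul hμc).intervalIntegrable_of_Icc zero_le_one)
        ((hφ'.continuousOn.mul hGc).intervalIntegrable_of_Icc zero_le_one),
        h.weak_eq φ hφ hφc hφt x, integral_deriv_mul_primitive hφ h1 hg]
      ring
  · intro h
    refine ⟨h.continuousOn, h.integrableOn, h.mem_simplex, fun φ hφ hφc hφt x => ?_, h.initial,
      h.terminal⟩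
    have hg := intervalIntegrable_divergence h.integrableOn x (s := 0) (t := 1) (by simp) (by simp)
    have hGc := continuousOn_primitive_divergence h.integrableOn x
    have hφ' : Continuous (deriv φ) := hφ.continuous_deriv (by exact_mod_cast le_top)
    have h0 : φ 0 = 0 := image_eq_zero_of_notMem_tsupport fun h => by simpa using (hφt h).1
    have h1 : φ 1 = 0 := image_eq_zero_of_notMem_tsupport fun h => by simpa using (hφt h).2
    have h2 : ∫ t in (0 : ℝ)..1, deriv φ t = 0 := by
      rw [intervalIntegral.integral_deriv_eq_sub
        (fun t _ => (hφ.differentiable (by simp)).differentiableAt)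
        (hφ'.intervalIntegrable _ _), h0, h1, sub_zero]
    calc ∫ t in (0 : ℝ)..1, deriv φ t * μ t x
        = ∫ t in (0 : ℝ)..1, (deriv φ t * μ₀ x -
            deriv φ t * ∫ s in (0 : ℝ)..t, divergence (V s) x) := by
          refine intervalIntegral.integral_congr fun t ht => ?_
          rw [uIcc_of_le zero_le_one] at ht
          simp only [h.eq_sub_integral t ht x, mul_sub]
      _ = _ := by
          rw [intervalIntegral.integral_sub (f := fun t => deriv φ t * μ₀ x)
            (g := fun t => deriv φ t * ∫ s in (0 : ℝ)..t, divergence (V s) x)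
            ((hφ'.mul continuous_const).intervalIntegrable _ _)
            ((hφ'.continuousOn.mul hGc).intervalIntegrable_of_Icc zero_le_one),
            intervalIntegral.integral_mul_const, h2, integral_deriv_mul_primitive hφ h1 hg]
          ring

end

/-! ### Rescaling and concatenation of solutions -/

section

variable {X : Type*} [Fintype X] {Λ : ℝ → ℝ → ℝ}

theorem divergence_smul (c : ℝ) (V : X → X → ℝ) (x : X) :
    divergence (c • V) x = c * divergence V x := by
  simp only [divergence, Pi.smul_apply, smul_eq_mul, ← mul_sub, ← Finset.mul_sum]
  ring

theorem divergence_add (V U : X → X → ℝ) (x : X) :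
    divergence (V + U) x = divergence V x + divergence U x := by
  simp only [divergence, Pi.add_apply, ← mul_add, ← Finset.sum_add_distrib]
  congr 1
  exact Finset.sum_congr rfl fun y _ => by ring

/-- Change of variables onto the image of `S`. Asking only for an inequality lets `c = 0` and an
arbitrary target `T` be included, and `F` need not be measurable. -/
theorem lintegral_comp_affine_le (F : ℝ → ℝ≥0∞) {S T : Set ℝ} (hS : MeasurableSet S) (c d : ℝ)
    (hST : ∀ r ∈ S, d + c * r ∈ T) :
    ENNReal.ofReal |c| * ∫⁻ r in S, F (d + c * r) ≤ ∫⁻ r in T, F r := by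
  rcases eq_or_ne c 0 with rfl | hc
  · simp
  rw [← lintegral_const_mul' _ _ ENNReal.ofReal_ne_top]
  have h := lintegral_image_eq_lintegral_abs_deriv_mul hS (f := fun r => d + c * r)
    (f' := fun _ => c) (fun r _ => by
      simpa using (((hasDerivAt_id r).const_mul c).const_add d).hasDerivWithinAt)
    (fun x _ y _ hxy => by simpa [hc] using hxy) F
  rw [← h]
  exact lintegral_mono_set (image_subset_iff.2 hST)

/-- Of the factor `c ^ 2` from quadratic homogeneity, the change of variables absorbs one `|c|`. -/
theorem MarkovTriple.lintegral_action_affine_le (M : MarkovTriple X) (hΛ : IsAdmissibleMean Λ)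
    {μ : ℝ → X → ℝ} (V : ℝ → X → X → ℝ) {S T : Set ℝ} (hS : MeasurableSet S) (c d : ℝ)
    (hST : ∀ r ∈ S, d + c * r ∈ T) (hμ : ∀ t ∈ T, 0 ≤ μ t) :
    ∫⁻ r in S, M.action Λ (μ (d + c * r)) (c • V (d + c * r)) ≤
      ENNReal.ofReal |c| * ∫⁻ r in T, M.action Λ (μ r) (V r) := by
  calc ∫⁻ r in S, M.action Λ (μ (d + c * r)) (c • V (d + c * r))
      = ∫⁻ r in S, ENNReal.ofReal (c ^ 2) * M.action Λ (μ (d + c * r)) (V (d + c * r)) :=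
        setLIntegral_congr_fun hS fun r hr => M.action_smul hΛ (hμ _ (hST r hr)) c _
    _ = ENNReal.ofReal |c| *
        (ENNReal.ofReal |c| * ∫⁻ r in S, M.action Λ (μ (d + c * r)) (V (d + c * r))) := by
        rw [lintegral_const_mul' _ _ ENNReal.ofReal_ne_top, ← mul_assoc,
          ← ENNReal.ofReal_mul (abs_nonneg c), ← sq, sq_abs]
    _ ≤ _ := by
        gcongr
        exact lintegral_comp_affine_le (fun r => M.action Λ (μ r) (V r)) hS c d hST

theorem intervalIntegrable_comp_affine {f : ℝ → ℝ} {a b c d : ℝ}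
    (h : IntervalIntegrable f volume (d + c * a) (d + c * b)) (hc : c ≠ 0) :
    IntervalIntegrable (fun r => f (d + c * r)) volume a b := by
  have h1 := (h.comp_add_left d).comp_mul_left (c := c)
  simpa [hc] using h1

theorem add_mul_sub_mem_Icc {s t r : ℝ} (hs : s ∈ Icc (0 : ℝ) 1) (ht : t ∈ Icc (0 : ℝ) 1)
    (hr : r ∈ Icc (0 : ℝ) 1) : s + (t - s) * r ∈ Icc (0 : ℝ) 1 := by
  have := (convex_Icc (0 : ℝ) 1).add_smul_sub_mem hs ht hr
  simpa [mul_comm] using this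

/-- Restriction of a solution to a subinterval, affinely rescaled (and reversed if `t < s`). -/
theorem IntegralSolution.restrict {μ₀ μ₁ : X → ℝ} {μ : ℝ → X → ℝ} {V : ℝ → X → X → ℝ}
    (h : IntegralSolution μ₀ μ₁ μ V) {s t : ℝ} (hs : s ∈ Icc (0 : ℝ) 1) (ht : t ∈ Icc (0 : ℝ) 1) :
    IntegralSolution (μ s) (μ t) (fun r => μ (s + (t - s) * r))
      (fun r => (t - s) • V (s + (t - s) * r)) where
  integrableOn x y := by
    rcases eq_or_ne (t - s) 0 with hts | hts
    · simp [hts]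
    · rw [← intervalIntegrable_iff_integrableOn_Icc_of_le zero_le_one]
      refine IntervalIntegrable.const_mul (f := fun r => V (s + (t - s) * r) x y)
        (intervalIntegrable_comp_affine (f := fun r => V r x y) ?_ hts) _
      exact ((h.integrableOn x y).mono_set
        (uIcc_subset_Icc (by simpa using hs) (by simpa using ht))).intervalIntegrable
  mem_simplex r hr := h.mem_simplex _ (add_mul_sub_mem_Icc hs ht hr)
  eq_sub_integral r hr x := by
    have h0 : (0 : ℝ) ∈ Icc (0 : ℝ) 1 := by simp
    have hr' := add_mul_sub_mem_Icc hs ht hr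
    have h1 := intervalIntegral.integral_add_adjacent_intervals
      (intervalIntegrable_divergence h.integrableOn x h0 hs)
      (intervalIntegrable_divergence h.integrableOn x hs hr')
    have h2 := intervalIntegral.smul_integral_comp_add_mul (a := 0) (b := r)
      (fun u => divergence (V u) x) (t - s) s
    simp only [mul_zero, add_zero, smul_eq_mul] at h2
    simp only [divergence_smul]
    rw [intervalIntegral.integral_const_mul, h2, h.eq_sub_integral _ hr', h.eq_sub_integral s hs]
    linarith
  terminal := by simp

/-- Concatenation of two solutions, run on `[0, l]` and on `[l, 1]`. -/
theorem IntegralSolution.exists_glue (M : MarkovTriple X) (hΛ : IsAdmissibleMean Λ)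
    {a b c : X → ℝ} {μ ν : ℝ → X → ℝ} {V U : ℝ → X → X → ℝ}
    (h : IntegralSolution a b μ V) (h' : IntegralSolution b c ν U) {l : ℝ} (hl0 : 0 < l)
    (hl1 : l < 1) : ∃ ρ R, IntegralSolution a c ρ R ∧ M.totalAction Λ ρ R ≤
      ENNReal.ofReal l⁻¹ * M.totalAction Λ μ V +
        ENNReal.ofReal (1 - l)⁻¹ * M.totalAction Λ ν U := by
  have hl : 0 < 1 - l := by linarith
  set k : ℝ := (1 - l)⁻¹ with hk
  have hk0 : 0 < k := inv_pos.2 hl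
  have hkl : k * (1 - l) = 1 := inv_mul_cancel₀ hl.ne'
  have hll : l⁻¹ * l = 1 := inv_mul_cancel₀ hl0.ne'
  -- The map `r ↦ d + k * r` sends `l` to 0 and 1 to 1.
  set d : ℝ := -(k * l) with hd
  have hm1 : ∀ r ∈ Icc 0 l, 0 + l⁻¹ * r ∈ Icc (0 : ℝ) 1 := fun r hr => by
    rw [zero_add, ← hll]
    exact ⟨mul_nonneg (by positivity) hr.1, by gcongr; exact hr.2⟩
  have hm2 : ∀ r ∈ Icc l 1, d + k * r ∈ Icc (0 : ℝ) 1 := fun r hr => by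
    constructor <;> nlinarith [hr.1, hr.2]
  set ρ : ℝ → X → ℝ := fun t => if t ≤ l then μ (0 + l⁻¹ * t) else ν (d + k * t) with hρ
  set R : ℝ → X → X → ℝ := fun t => if t ≤ l then l⁻¹ • V (0 + l⁻¹ * t) else k • U (d + k * t)
    with hR
  have hR1 : ∀ t ∈ Ioc 0 l, R t = l⁻¹ • V (0 + l⁻¹ * t) := fun t ht => if_pos ht.2
  have hR2 : ∀ t ∈ Ioc l 1, R t = k • U (d + k * t) := fun t ht => if_neg (not_le.2 ht.1)
  have hρ1 : ∀ t ∈ Ioc 0 l, ρ t = μ (0 + l⁻¹ * t) := fun t ht => if_pos ht.2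
  have hρ2 : ∀ t ∈ Ioc l 1, ρ t = ν (d + k * t) := fun t ht => if_neg (not_le.2 ht.1)
  have hint : ∀ x y, IntegrableOn (fun t => R t x y) (Icc 0 1) volume := fun x y => by
    rw [← intervalIntegrable_iff_integrableOn_Icc_of_le zero_le_one]
    refine IntervalIntegrable.trans (b := l) ?_ ?_
    · have h1 : IntervalIntegrable (fun r => V (0 + l⁻¹ * r) x y) volume 0 l :=
        intervalIntegrable_comp_affine (f := fun r => V r x y)
          (by
            rw [mul_zero, add_zero, zero_add, hll]
            exact (intervalIntegrable_iff_integrableOn_Icc_of_le zero_le_one).2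
              (h.integrableOn x y)) (by positivity)
      refine (h1.const_mul l⁻¹).congr fun t ht => ?_
      rw [uIoc_of_le hl0.le] at ht
      simp [hR1 t ht]
    · have h1 : IntervalIntegrable (fun r => U (d + k * r) x y) volume l 1 :=
        intervalIntegrable_comp_affine (f := fun r => U r x y)
          (by
            have e : d + k * 1 = 1 := by linarith
            have e' : d + k * l = 0 := by linarith
            rw [e, e']
            exact (intervalIntegrable_iff_integrableOn_Icc_of_le zero_le_one).2
              (h'.integrableOn x y)) hk0.ne'
      refine (h1.const_mul k).congr fun t ht => ?_
      rw [uIoc_of_le hl1.le] at ht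
      simp [hR2 t ht]
  have hI1 : ∀ t ∈ Icc 0 l, ∀ x, ∫ s in (0 : ℝ)..t, divergence (R s) x =
      ∫ s in (0 : ℝ)..(0 + l⁻¹ * t), divergence (V s) x := fun t ht x => by
    have h2 := intervalIntegral.smul_integral_comp_add_mul (a := 0) (b := t)
      (fun u => divergence (V u) x) l⁻¹ 0
    rw [smul_eq_mul, ← intervalIntegral.integral_const_mul, mul_zero, add_zero] at h2
    rw [← h2]
    refine intervalIntegral.integral_congr_ae (ae_of_all _ fun s hs => ?_)
    rw [uIoc_of_le ht.1] at hs
    rw [hR1 s ⟨hs.1, hs.2.trans ht.2⟩, divergence_smul]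
  have hI2 : ∀ t ∈ Icc l 1, ∀ x, ∫ s in l..t, divergence (R s) x =
      ∫ s in (0 : ℝ)..(d + k * t), divergence (U s) x := fun t ht x => by
    have h2 := intervalIntegral.smul_integral_comp_add_mul (a := l) (b := t)
      (fun u => divergence (U u) x) k d
    have e' : d + k * l = 0 := by linarith
    rw [smul_eq_mul, ← intervalIntegral.integral_const_mul, e'] at h2
    rw [← h2]
    refine intervalIntegral.integral_congr_ae (ae_of_all _ fun s hs => ?_)
    rw [uIoc_of_le ht.1] at hs
    rw [hR2 s ⟨hs.1, hs.2.trans ht.2⟩, divergence_smul]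
  refine ⟨ρ, R, ⟨hint, ?_, ?_, ?_⟩, ?_⟩
  · intro t ht
    by_cases htl : t ≤ l
    · simp only [hρ, if_pos htl]
      exact h.mem_simplex _ (hm1 t ⟨ht.1, htl⟩)
    · simp only [hρ, if_neg htl]
      exact h'.mem_simplex _ (hm2 t ⟨(not_le.1 htl).le, ht.2⟩)
  · intro t ht x
    by_cases htl : t ≤ l
    · rw [hI1 t ⟨ht.1, htl⟩]
      simp only [hρ, if_pos htl]
      exact h.eq_sub_integral _ (hm1 t ⟨ht.1, htl⟩) x
    · have htl' := (not_le.1 htl).le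
      rw [← intervalIntegral.integral_add_adjacent_intervals
        (intervalIntegrable_divergence hint x (by simp) ⟨hl0.le, hl1.le⟩)
        (intervalIntegrable_divergence hint x ⟨hl0.le, hl1.le⟩ ht), hI2 t ⟨htl', ht.2⟩,
        hI1 l ⟨hl0.le, le_rfl⟩, zero_add, hll]
      have e1 := h.eq_sub_integral 1 (by simp) x
      have e2 := h'.eq_sub_integral _ (hm2 t ⟨htl', ht.2⟩) x
      rw [h.terminal] at e1
      simp only [hρ, if_neg htl]
      linarith
  · simp only [hρ, if_neg (not_le.2 hl1)]
    have e : d + k * 1 = 1 := by linarith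
    rw [e, h'.terminal]
  · unfold MarkovTriple.totalAction
    rw [setLIntegral_congr (Ioc_ae_eq_Icc (μ := volume) (a := (0 : ℝ)) (b := 1)).symm,
      ← Ioc_union_Ioc_eq_Ioc hl0.le hl1.le,
      lintegral_union measurableSet_Ioc (Ioc_disjoint_Ioc_of_le le_rfl)]
    rw [setLIntegral_congr_fun measurableSet_Ioc fun t ht => by rw [hρ1 t ht, hR1 t ht],
      setLIntegral_congr_fun (s := Ioc l 1) measurableSet_Ioc
        fun t ht => by rw [hρ2 t ht, hR2 t ht]]
    have e1 := M.lintegral_action_affine_le hΛ V (measurableSet_Ioc (a := 0) (b := l)) l⁻¹ 0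
      (fun r hr => hm1 r (Ioc_subset_Icc_self hr)) (fun t ht => (h.mem_simplex t ht).1)
    have e2 := M.lintegral_action_affine_le hΛ U (measurableSet_Ioc (a := l) (b := 1)) k d
      (fun r hr => hm2 r (Ioc_subset_Icc_self hr)) (fun t ht => (h'.mem_simplex t ht).1)
    rw [abs_of_pos (inv_pos.2 hl0)] at e1
    rw [abs_of_pos hk0] at e2
    exact add_le_add e1 e2

end

/-! ### Competitors of finite action -/

section

variable {X : Type*} [Fintype X] {Λ : ℝ → ℝ → ℝ}

namespace MarkovTriple

/-- Some point has positive mass, and detailed balance propagates positivity along paths of positive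
rates. -/
theorem pi_pos (M : MarkovTriple X) (x : X) : 0 < M.pi x := by
  obtain ⟨z, -, hz⟩ : ∃ z ∈ Finset.univ, M.pi z ≠ 0 :=
    Finset.exists_ne_zero_of_sum_ne_zero (by rw [M.pi_mem.2]; exact one_ne_zero)
  induction M.irreducible z x with
  | refl => exact (M.pi_mem.1 z).lt_of_ne' hz
  | @tail a b _ hab ih =>
    refine (M.pi_mem.1 b).lt_of_ne' fun h => ?_
    have := M.detailed_balance a b
    rw [h, zero_mul] at this
    exact (mul_pos ih hab).ne' this

theorem exists_divergence_eq_single_sub_single [DecidableEq X] (M : MarkovTriple X) (x y : X) :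
    ∃ U : X → X → ℝ, (∀ a b, M.Q a b = 0 → U a b = 0) ∧
      ∀ z, divergence U z = (if z = x then 1 else 0) - (if z = y then 1 else 0) := by
  induction M.irreducible x y with
  | refl => exact ⟨0, fun _ _ _ => rfl, fun z => by simp [divergence]⟩
  | @tail a b _ hab ih =>
    obtain ⟨U, hU, hUd⟩ := ih
    -- A unit flow through the last edge extends the path; the 2 cancels the 1/2 in the divergence.
    refine ⟨U + fun u v => if u = a ∧ v = b then 2 else 0, fun u v huv => ?_, fun z => ?_⟩
    · have : ¬(u = a ∧ v = b) := by
        rintro ⟨rfl, rfl⟩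
        exact hab.ne' huv
      simp [hU u v huv, this]
    · rw [divergence_add, hUd]
      have h1 : divergence (fun u v => if u = a ∧ v = b then (2 : ℝ) else 0) z =
          (if z = a then 1 else 0) - (if z = b then 1 else 0) := by
        have hne : a ≠ b := by
          rintro rfl
          exact hab.ne' (M.Q_diag a)
        simp only [divergence, Finset.sum_sub_distrib, ite_and]
        by_cases h1 : z = a <;> by_cases h2 : z = b <;> simp [h1, h2, hne, hne.symm]
      rw [h1]
      ring

/-- Send mass `f x` from each `x` to a base point `o`; the total arriving at `o` is zero. -/
theorem exists_divergence_eq (M : MarkovTriple X) (f : X → ℝ) (hf : ∑ x, f x = 0) :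
    ∃ U : X → X → ℝ, (∀ a b, M.Q a b = 0 → U a b = 0) ∧ ∀ z, divergence U z = f z := by
  classical
  rcases isEmpty_or_nonempty X with hX | ⟨⟨o⟩⟩
  · exact ⟨0, fun _ _ _ => rfl, fun z => isEmptyElim z⟩
  choose U hU hUd using fun x => M.exists_divergence_eq_single_sub_single x o
  refine ⟨fun a b => ∑ x, f x * U x a b, fun a b hab => ?_, fun z => ?_⟩
  · exact Finset.sum_eq_zero fun x _ => by rw [hU x a b hab, mul_zero]
  · have : divergence (fun a b => ∑ x, f x * U x a b) z = ∑ x, f x * divergence (U x) z := by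
      simp only [divergence, ← Finset.sum_sub_distrib, ← mul_sub]
      rw [Finset.sum_comm, Finset.mul_sum]
      refine Finset.sum_congr rfl fun x _ => ?_
      rw [← Finset.mul_sum]
      ring
    rw [this]
    simp only [hUd, mul_sub, Finset.sum_sub_distrib, ← Finset.sum_mul, hf]
    simp

/-- Any two probability vectors are joined by a solution of finite action, which passes through the
interior of the simplex. -/
theorem exists_totalAction_ne_top (M : MarkovTriple X) (hΛ : IsAdmissibleMean Λ) {μ₀ μ₁ : X → ℝ}
    (hμ₀ : μ₀ ∈ stdSimplex ℝ X) (hμ₁ : μ₁ ∈ stdSimplex ℝ X) :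
    ∃ μ V, IntegralSolution μ₀ μ₁ μ V ∧ M.totalAction Λ μ V ≠ ⊤ := by
  obtain ⟨U₀, hU₀, hd₀⟩ := M.exists_divergence_eq (fun x => μ₀ x - M.pi x)
    (by rw [Finset.sum_sub_distrib, hμ₀.2, M.pi_mem.2, sub_self])
  obtain ⟨U₁, hU₁, hd₁⟩ := M.exists_divergence_eq (fun x => μ₁ x - M.pi x)
    (by rw [Finset.sum_sub_distrib, hμ₁.2, M.pi_mem.2, sub_self])
  -- `c` is the weight of `M.pi`. Its double zeros at the endpoints match the factor `t * (1 - t)`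
  -- in the momentum, so that the quotient of the squared momentum by `c` stays bounded.
  set c : ℝ → ℝ := fun t => t ^ 2 * (1 - t) ^ 2 with hc
  set a : ℝ → ℝ := fun t => 1 - (3 * t ^ 2 - 2 * t ^ 3) - c t / 2 with ha
  set b : ℝ → ℝ := fun t => 3 * t ^ 2 - 2 * t ^ 3 - c t / 2 with hb
  have habc : ∀ t, a t + b t + c t = 1 := fun t => by simp only [ha, hb]; ring
  have hc0 : ∀ t, 0 ≤ c t := fun t => by positivity
  have ha0 : ∀ t ∈ Icc (0 : ℝ) 1, 0 ≤ a t := fun t ht => by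
    have : a t = (1 - t) ^ 2 * (1 + 2 * t - t ^ 2 / 2) := by simp only [ha, hc]; ring
    rw [this]
    exact mul_nonneg (sq_nonneg _) (by nlinarith [ht.1, ht.2])
  have hb0 : ∀ t ∈ Icc (0 : ℝ) 1, 0 ≤ b t := fun t ht => by
    have : b t = t ^ 2 * (3 - 2 * t - (1 - t) ^ 2 / 2) := by simp only [hb, hc]; ring
    rw [this]
    exact mul_nonneg (sq_nonneg _) (by nlinarith [ht.1, ht.2])
  set μ : ℝ → X → ℝ := fun t => a t • μ₀ + b t • μ₁ + c t • M.pi with hμ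
  -- The derivatives of the weights are `a' = -t(1-t)(7-2t)` and `b' = t(1-t)(5+2t)`, and `c' = -a'
  -- - b'`; hence minus the derivative of the curve is a combination of the divergences of `U₀` and
  -- `U₁`.
  set V : ℝ → X → X → ℝ := fun t => (t * (1 - t)) • ((7 - 2 * t) • U₀ + (-(5 + 2 * t)) • U₁) with hV
  have hVc : ∀ x y, Continuous fun t => V t x y := fun x y => by
    simp only [hV, Pi.smul_apply, Pi.add_apply, smul_eq_mul]
    fun_prop
  have hpow : ∀ (n : ℕ) (t : ℝ), HasDerivAt (fun t : ℝ => t ^ n) (n * t ^ (n - 1)) t :=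
    fun n t => hasDerivAt_pow n t
  have hderiv : ∀ x t, HasDerivAt (fun t => -(μ t x)) (divergence (V t) x) t := fun x t => by
    have hcd : HasDerivAt c (2 * t * (1 - t) ^ 2 - t ^ 2 * (2 * (1 - t))) t := by
      have := (hpow 2 t).mul (((hasDerivAt_id t).const_sub 1).pow 2)
      refine this.congr_deriv ?_
      simp
      ring
    have hqd : HasDerivAt (fun t : ℝ => 3 * t ^ 2 - 2 * t ^ 3) (6 * t - 6 * t ^ 2) t := by
      refine (((hpow 2 t).const_mul 3).sub ((hpow 3 t).const_mul 2)).congr_deriv ?_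
      norm_num
      ring
    have had := (hqd.const_sub 1).sub (hcd.div_const 2)
    have hbd := hqd.sub (hcd.div_const 2)
    have := (((had.mul_const (μ₀ x)).add (hbd.mul_const (μ₁ x))).add (hcd.mul_const (M.pi x))).neg
    refine HasDerivAt.congr_deriv (f := fun t => -(μ t x)) this ?_
    simp only [hV, divergence_smul, divergence_add, hd₀, hd₁]
    ring
  have hsimplex : ∀ t ∈ Icc (0 : ℝ) 1, μ t ∈ stdSimplex ℝ X := fun t ht => by
    refine ⟨fun x => ?_, ?_⟩
    · have := mul_nonneg (ha0 t ht) (hμ₀.1 x)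
      have := mul_nonneg (hb0 t ht) (hμ₁.1 x)
      have := mul_nonneg (hc0 t) (M.pi_mem.1 x)
      simp only [hμ, Pi.add_apply, Pi.smul_apply, smul_eq_mul]
      linarith
    · simp only [hμ, Pi.add_apply, Pi.smul_apply, smul_eq_mul, Finset.sum_add_distrib,
        ← Finset.mul_sum, hμ₀.2, hμ₁.2, M.pi_mem.2, mul_one, habc]
  have hμ0 : μ 0 = μ₀ := by simp [hμ, ha, hb, hc]
  have hμ1 : μ 1 = μ₁ := by
    have h1 : a 1 = 0 := by simp only [ha, hc]; norm_num
    have h2 : b 1 = 1 := by simp only [hb, hc]; norm_num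
    have h3 : c 1 = 0 := by simp only [hc]; norm_num
    simp [hμ, h1, h2, h3]
  refine ⟨μ, V, ⟨fun x y => (hVc x y).integrableOn_Icc, hsimplex, fun t ht x => ?_, hμ1⟩, ?_⟩
  · rw [intervalIntegral.integral_eq_sub_of_hasDerivAt (fun t _ => hderiv x t), hμ0]
    · ring
    · have : Continuous fun t => divergence (V t) x := by
        simp only [divergence]
        have := hVc
        fun_prop
      exact this.intervalIntegrable _ _
  -- The 7 bounds both `7 - 2 * t` and `5 + 2 * t` on the unit interval; the weight `c t` has
  -- cancelled.
  · set D : X → X → ℝ := fun x y => (7 * (|U₀ x y| + |U₁ x y|)) ^ 2 / (M.pi x * M.Q x y) with hD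
    have hedge : ∀ t ∈ Icc (0 : ℝ) 1, ∀ x y,
        edgeAction Λ (μ t x * M.Q x y) (μ t y * M.Q y x) (V t x y) ≤ ENNReal.ofReal (D x y) := by
      intro t ht x y
      have hμ' := (hsimplex t ht).1
      -- Here the lower bound on the fluxes degenerates, but the momentum vanishes as well, either
      -- because `t` is an endpoint or because the edge has rate zero.
      by_cases h0 : c t * (M.pi x * M.Q x y) = 0
      · have : V t x y = 0 := by
          rcases mul_eq_zero.1 h0 with h | h
          · have : t * (1 - t) = 0 := by
              have h2 : (t * (1 - t)) ^ 2 = 0 := by rw [mul_pow]; exact h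
              exact pow_eq_zero_iff two_ne_zero |>.1 h2
            simp [hV, this]
          · have hQ := (mul_eq_zero.1 h).resolve_left (M.pi_pos x).ne'
            simp [hV, hU₀ x y hQ, hU₁ x y hQ]
        rw [this, hΛ.edgeAction_zero (mul_nonneg (hμ' x) (M.Q_nonneg x y))
          (mul_nonneg (hμ' y) (M.Q_nonneg y x))]
        exact zero_le
      · have hm : 0 < c t * (M.pi x * M.Q x y) :=
          (mul_nonneg (hc0 t) (mul_nonneg (M.pi_mem.1 x) (M.Q_nonneg x y))).lt_of_ne' h0
        have hge : ∀ z, c t * M.pi z ≤ μ t z := fun z => by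
          have := mul_nonneg (ha0 t ht) (hμ₀.1 z)
          have := mul_nonneg (hb0 t ht) (hμ₁.1 z)
          simp only [hμ, Pi.add_apply, Pi.smul_apply, smul_eq_mul]
          linarith
        refine (hΛ.edgeAction_le_ofReal hm ?_ ?_ _).trans (ENNReal.ofReal_le_ofReal ?_)
        · rw [← mul_assoc]
          exact mul_le_mul_of_nonneg_right (hge x) (M.Q_nonneg x y)
        · rw [M.detailed_balance, ← mul_assoc]
          exact mul_le_mul_of_nonneg_right (hge y) (M.Q_nonneg y x)
        · have hVe : V t x y ^ 2 = c t * ((7 - 2 * t) * U₀ x y + -(5 + 2 * t) * U₁ x y) ^ 2 := by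
            simp only [hV, hc, Pi.smul_apply, Pi.add_apply, smul_eq_mul]
            ring
          have hct : c t ≠ 0 := left_ne_zero_of_mul h0
          rw [hVe, mul_div_mul_left _ _ hct]
          refine div_le_div_of_nonneg_right ?_ (mul_nonneg (M.pi_mem.1 x) (M.Q_nonneg x y))
          rw [sq_le_sq, abs_of_nonneg (by positivity : 0 ≤ 7 * (|U₀ x y| + |U₁ x y|))]
          refine (abs_add_le _ _).trans ?_
          rw [abs_mul, abs_mul, abs_neg, abs_of_nonneg (by linarith [ht.2] : 0 ≤ 7 - 2 * t),
            abs_of_nonneg (by linarith [ht.1] : 0 ≤ 5 + 2 * t)]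
          nlinarith [abs_nonneg (U₀ x y), abs_nonneg (U₁ x y), ht.1, ht.2]
    refine ne_top_of_le_ne_top (b := ∫⁻ _ in Icc (0 : ℝ) 1,
      2⁻¹ * ∑ x, ∑ y, ENNReal.ofReal (D x y)) ?_ ?_
    · rw [setLIntegral_const]
      refine ENNReal.mul_ne_top (ENNReal.mul_ne_top (by simp) ?_) (by simp)
      simp [ENNReal.sum_eq_top]
    · refine setLIntegral_mono' measurableSet_Icc fun t ht => ?_
      unfold action
      gcongr with x _ y
      exact hedge t ht x y

end MarkovTriple

end

/-! ### The direct method in a Hilbert space -/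

section Hilbert

open Filter Topology

variable {H : Type*} [NormedAddCommGroup H] [InnerProductSpace ℝ H] [CompleteSpace H]

/-- A decreasing sequence of nonempty bounded closed convex sets in a Hilbert space has nonempty
intersection. -/
theorem nonempty_iInter_of_convex {K : ℕ → Set H} (hanti : Antitone K)
    (hne : ∀ n, (K n).Nonempty) (hclosed : ∀ n, IsClosed (K n)) (hconv : ∀ n, Convex ℝ (K n))
    {R : ℝ} (hbdd : ∀ v ∈ K 0, ‖v‖ ≤ R) : (⋂ n, K n).Nonempty := by
  have hmin : ∀ n, ∃ v ∈ K n, ∀ w ∈ K n, ‖v‖ ≤ ‖w‖ := fun n => by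
    obtain ⟨v, hv, h⟩ := exists_norm_eq_iInf_of_complete_convex (hne n) (hclosed n).isComplete
      (hconv n) 0
    refine ⟨v, hv, fun w hw => ?_⟩
    have : ⨅ w : K n, ‖(0 : H) - w‖ ≤ ‖(0 : H) - (⟨w, hw⟩ : K n)‖ :=
      ciInf_le ⟨0, by rintro _ ⟨w, rfl⟩; exact norm_nonneg _⟩ _
    rw [← h] at this
    simpa using this
  choose z hz hzmin using hmin
  have hmono : Monotone fun n => ‖z n‖ := fun n m hnm => hzmin n _ (hanti hnm (hz m))
  have hbd : BddAbove (range fun n => ‖z n‖) :=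
    ⟨R, by rintro _ ⟨n, rfl⟩; exact hbdd _ (hanti (Nat.zero_le n) (hz n))⟩
  have hlim := tendsto_atTop_ciSup hmono hbd
  set L := ⨆ n, ‖z n‖
  have hle : ∀ n, ‖z n‖ ≤ L := fun n => le_ciSup hbd n
  -- The midpoint of `z n` and `z m` lies in `K n`, so its norm is at least `‖z n‖`; the
  -- parallelogram law then makes the points of least norm a Cauchy sequence.
  have hpar : ∀ n m, n ≤ m → ‖z n - z m‖ ^ 2 ≤ 2 * (L ^ 2 - ‖z n‖ ^ 2) := fun n m hnm => by
    have h1 : (1 / 2 : ℝ) • z n + (1 / 2 : ℝ) • z m ∈ K n :=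
      hconv n (hz n) (hanti hnm (hz m)) (by norm_num) (by norm_num) (by norm_num)
    have h2 := hzmin n _ h1
    rw [← smul_add, norm_smul, Real.norm_of_nonneg (by norm_num)] at h2
    have h3 := parallelogram_law_with_norm ℝ (z n) (z m)
    have h4 := hle m
    nlinarith [norm_nonneg (z n), norm_nonneg (z m), norm_nonneg (z n + z m)]
  have hcauchy : CauchySeq z := by
    have hb : Tendsto (fun n => Real.sqrt (2 * (L ^ 2 - ‖z n‖ ^ 2))) atTop (𝓝 0) := by
      have := ((((hlim.pow 2).const_sub (L ^ 2)).const_mul 2)).sqrt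
      simpa using this
    refine cauchySeq_of_le_tendsto_0' _ (fun n m hnm => ?_) hb
    rw [dist_eq_norm]
    exact Real.le_sqrt_of_sq_le (hpar n m hnm)
  obtain ⟨v, hv⟩ := cauchySeq_tendsto_of_complete hcauchy
  refine ⟨v, mem_iInter.2 fun n => (hclosed n).mem_of_tendsto hv ?_⟩
  filter_upwards [eventually_ge_atTop n] with m hm using hanti hm (hz m)

/-- The direct method: a functional on a Hilbert space whose finite sublevel sets are closed, convex
and bounded attains its infimum. -/
theorem exists_forall_le_of_sublevel (J : H → ℝ≥0∞)
    (hclosed : ∀ c ≠ ⊤, IsClosed {v | J v ≤ c}) (hconv : ∀ c ≠ ⊤, Convex ℝ {v | J v ≤ c})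
    (hbdd : ∀ c ≠ ⊤, ∃ R : ℝ, ∀ v, J v ≤ c → ‖v‖ ≤ R) : ∃ v, ∀ w, J v ≤ J w := by
  by_cases htop : ⨅ v, J v = ⊤
  · exact ⟨0, fun w => by rw [iInf_eq_top.1 htop w]; exact le_top⟩
  obtain ⟨u, huanti, hu, hulim⟩ := exists_seq_strictAnti_tendsto' (lt_top_iff_ne_top.2 htop)
  have hutop : ∀ n, u n ≠ ⊤ := fun n => (hu n).2.ne
  obtain ⟨R, hR⟩ := hbdd (u 0) (hutop 0)
  obtain ⟨v, hv⟩ := nonempty_iInter_of_convex (K := fun n => {v | J v ≤ u n})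
    (fun n m hnm v hv => le_trans hv (huanti.antitone hnm))
    (fun n => by
      obtain ⟨v, hv⟩ := iInf_lt_iff.1 (hu n).1
      exact ⟨v, hv.le⟩)
    (fun n => hclosed _ (hutop n)) (fun n => hconv _ (hutop n)) (R := R) hR
  refine ⟨v, fun w => le_trans ?_ (iInf_le J w)⟩
  exact ge_of_tendsto' hulim fun n => mem_iInter.1 hv n

end Hilbert

/-! ### Existence of action minimisers -/

section

open Filter Topology

variable {X : Type*} [Fintype X] {Λ : ℝ → ℝ → ℝ}

/-- Momentum fields of finite energy. -/
abbrev MomentumSpace (X : Type*) [Fintype X] : Type _ :=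
  Lp (EuclideanSpace ℝ (X × X)) 2 (volume.restrict (Icc (0 : ℝ) 1))

namespace MomentumSpace

/-- The momentum field represented by an element of the Hilbert space. -/
noncomputable def field (v : MomentumSpace X) (t : ℝ) (x y : X) : ℝ :=
  (v : ℝ → EuclideanSpace ℝ (X × X)) t (x, y)

/-- The curve with initial value `μ₀` driven by a momentum field. -/
noncomputable def curve (μ₀ : X → ℝ) (v : MomentumSpace X) (t : ℝ) (x : X) : ℝ :=
  μ₀ x - ∫ s in (0 : ℝ)..t, divergence (v.field s) x

theorem integrableOn_field (v : MomentumSpace X) (x y : X) :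
    IntegrableOn (fun t => v.field t x y) (Icc 0 1) volume :=
  (EuclideanSpace.proj (𝕜 := ℝ) (x, y)).integrable_comp ((Lp.memLp v).integrable one_le_two)

/-- The pairing is with a constant vector times the indicator of `(0, t]`. It makes the curve, at
each fixed time, affine and continuous in the momentum. -/
theorem exists_integral_divergence_eq_inner {t : ℝ} (ht : t ∈ Icc (0 : ℝ) 1) (x : X) :
    ∃ k : MomentumSpace X, ∀ v : MomentumSpace X,
      ∫ s in (0 : ℝ)..t, divergence (v.field s) x = inner ℝ k v := by
  classical
  -- The coefficients of the divergence at `x` as a linear form in the momentum.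
  set c : EuclideanSpace ℝ (X × X) := WithLp.toLp 2 fun p =>
    (1 / 2) * ((if p.1 = x then 1 else 0) - (if p.2 = x then 1 else 0)) with hc
  refine ⟨indicatorConstLp 2 (measurableSet_Ioc (a := 0) (b := t)) (measure_ne_top _ _) c,
    fun v => ?_⟩
  rw [L2.inner_indicatorConstLp_eq_setIntegral_inner,
    Measure.restrict_restrict measurableSet_Ioc,
    inter_eq_left.2 (Ioc_subset_Icc_self.trans (Icc_subset_Icc_right ht.2)),
    intervalIntegral.integral_of_le ht.1]
  congr 1
  ext s
  simp only [PiLp.inner_apply, hc, divergence, field, Fintype.sum_prod_type]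
  simp only [RCLike.inner_apply, conj_trivial, mul_sub, Finset.sum_sub_distrib]
  congr 1
  · rw [Finset.sum_comm]
    simp [Finset.mul_sum, mul_comm]
  · simp [Finset.mul_sum, mul_comm]

theorem curve_convex_comb (μ₀ : X → ℝ) (v w : MomentumSpace X) {a b : ℝ} (hab : a + b = 1) {t : ℝ}
    (ht : t ∈ Icc (0 : ℝ) 1) :
    curve μ₀ (a • v + b • w) t = a • curve μ₀ v t + b • curve μ₀ w t := by
  ext x
  obtain ⟨k, hk⟩ := exists_integral_divergence_eq_inner ht x
  simp only [curve, hk, Pi.add_apply, Pi.smul_apply, smul_eq_mul, inner_add_right,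
    inner_smul_right]
  linear_combination (- μ₀ x) * hab

theorem continuous_curve (μ₀ : X → ℝ) {t : ℝ} (ht : t ∈ Icc (0 : ℝ) 1) :
    Continuous fun v => curve μ₀ v t := by
  refine continuous_pi fun x => ?_
  obtain ⟨k, hk⟩ := exists_integral_divergence_eq_inner ht x
  simp only [curve, hk]
  fun_prop

/-- The driven curve stays in the simplex and ends at `μ₁`. -/
def Joins (μ₀ μ₁ : X → ℝ) (v : MomentumSpace X) : Prop :=
  (∀ t ∈ Icc (0 : ℝ) 1, curve μ₀ v t ∈ stdSimplex ℝ X) ∧ curve μ₀ v 1 = μ₁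

theorem Joins.integralSolution {μ₀ μ₁ : X → ℝ} {v : MomentumSpace X} (h : Joins μ₀ μ₁ v) :
    IntegralSolution μ₀ μ₁ (curve μ₀ v) v.field :=
  ⟨v.integrableOn_field, h.1, fun _ _ _ => rfl, h.2⟩

theorem convex_joins (μ₀ μ₁ : X → ℝ) : Convex ℝ {v : MomentumSpace X | Joins μ₀ μ₁ v} := by
  intro v hv w hw a b ha hb hab
  refine ⟨fun t ht => ?_, ?_⟩
  · rw [curve_convex_comb μ₀ v w hab ht]
    exact convex_stdSimplex ℝ X (hv.1 t ht) (hw.1 t ht) ha hb hab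
  · rw [curve_convex_comb μ₀ v w hab (by simp), hv.2, hw.2, ← add_smul, hab, one_smul]

theorem isClosed_joins (μ₀ μ₁ : X → ℝ) : IsClosed {v : MomentumSpace X | Joins μ₀ μ₁ v} := by
  simp only [Joins, Set.ofPred_and, Set.ofPred_forall]
  refine IsClosed.inter (isClosed_iInter fun t => isClosed_iInter fun ht => ?_) ?_
  · exact (isClosed_stdSimplex ℝ X).preimage (continuous_curve μ₀ ht)
  · exact isClosed_singleton.preimage (continuous_curve μ₀ (t := 1) (by simp))

end MomentumSpace

open MomentumSpace

theorem IntegralSolution.aemeasurable_extendedAction (M : MarkovTriple X)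
    (hΛ : IsAdmissibleMean Λ) {μ₀ μ₁ : X → ℝ} {μ : ℝ → X → ℝ} {V : ℝ → X → X → ℝ}
    (h : IntegralSolution μ₀ μ₁ μ V) :
    AEMeasurable (fun t => M.extendedAction Λ (μ t, V t)) (volume.restrict (Icc 0 1)) := by
  refine (M.measurable_extendedAction hΛ).comp_aemeasurable (AEMeasurable.prodMk ?_ ?_)
  · exact h.continuousOn.aemeasurable measurableSet_Icc
  · exact aemeasurable_pi_iff.2 fun x => aemeasurable_pi_iff.2 fun y =>
      (h.integrableOn x y).aestronglyMeasurable.aemeasurable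

theorem IntegralSolution.totalAction_eq (M : MarkovTriple X)
    (hΛ : IsAdmissibleMean Λ) {μ₀ μ₁ : X → ℝ} {μ : ℝ → X → ℝ} {V : ℝ → X → X → ℝ}
    (h : IntegralSolution μ₀ μ₁ μ V) :
    M.totalAction Λ μ V = ∫⁻ t in Icc (0 : ℝ) 1, M.extendedAction Λ (μ t, V t) :=
  setLIntegral_congr_fun measurableSet_Icc fun t ht =>
    M.action_eq_extendedAction hΛ (h.mem_simplex t ht).1 _

namespace MarkovTriple

/-- Finite action bounds the `L²` norm of the momentum. -/
theorem exists_eLpNorm_le (M : MarkovTriple X) (hΛ : IsAdmissibleMean Λ) :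
    ∃ C : ℝ, 0 < C ∧ ∀ (μ : ℝ → X → ℝ) (V : ℝ → X → X → ℝ),
      (∀ t ∈ Icc (0 : ℝ) 1, μ t ∈ stdSimplex ℝ X) →
      eLpNorm (fun t => (WithLp.toLp 2 fun p => V t p.1 p.2 : EuclideanSpace ℝ (X × X))) 2
        (volume.restrict (Icc 0 1)) ≤
        (ENNReal.ofReal C * M.totalAction Λ μ V) ^ (1 / 2 : ℝ) := by
  obtain ⟨C, hC, h⟩ := M.exists_sum_sq_le_action hΛ
  refine ⟨C, hC, fun μ V hμ => ?_⟩
  rw [eLpNorm_eq_lintegral_rpow_enorm_toReal two_ne_zero ENNReal.ofNat_ne_top]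
  simp only [ENNReal.toReal_ofNat]
  refine ENNReal.rpow_le_rpow ?_ (by norm_num)
  unfold totalAction
  rw [← lintegral_const_mul' _ _ ENNReal.ofReal_ne_top]
  refine setLIntegral_mono' measurableSet_Icc fun t ht => ?_
  refine le_trans (le_of_eq ?_) (h (μ t) (hμ t ht) (V t))
  rw [show (2 : ℝ) = ((2 : ℕ) : ℝ) by norm_num, ENNReal.rpow_natCast, ← ofReal_norm,
    ← ENNReal.ofReal_pow (norm_nonneg _), EuclideanSpace.norm_sq_eq, Fintype.sum_prod_type]
  simp

open Classical in
/-- The action as a functional on the space of momentum fields of finite energy. -/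
noncomputable def momentumAction (M : MarkovTriple X) (Λ : ℝ → ℝ → ℝ) (μ₀ μ₁ : X → ℝ)
    (v : MomentumSpace X) : ℝ≥0∞ :=
  if Joins μ₀ μ₁ v then M.totalAction Λ (curve μ₀ v) v.field else ⊤

theorem momentumAction_le_iff (M : MarkovTriple X) (μ₀ μ₁ : X → ℝ)
    (v : MomentumSpace X) {c : ℝ≥0∞} (hc : c ≠ ⊤) : M.momentumAction Λ μ₀ μ₁ v ≤ c ↔
      Joins μ₀ μ₁ v ∧ M.totalAction Λ (curve μ₀ v) v.field ≤ c := by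
  unfold momentumAction
  split_ifs with h <;> simp [h, hc]

/-- The curve is affine in the momentum and the action is jointly convex. -/
theorem convex_momentumAction_le (M : MarkovTriple X) (hΛ : IsAdmissibleMean Λ) (μ₀ μ₁ : X → ℝ)
    {c : ℝ≥0∞} (hc : c ≠ ⊤) : Convex ℝ {v | M.momentumAction Λ μ₀ μ₁ v ≤ c} := by
  intro v hv w hw a b ha hb hab
  simp only [mem_ofPred_eq, momentumAction_le_iff M μ₀ μ₁ _ hc] at hv hw ⊢
  refine ⟨convex_joins μ₀ μ₁ hv.1 hw.1 ha hb hab, ?_⟩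
  have hvI := hv.1.integralSolution
  have hwI := hw.1.integralSolution
  calc M.totalAction Λ (curve μ₀ (a • v + b • w)) (a • v + b • w : MomentumSpace X).field
      ≤ ∫⁻ t in Icc (0 : ℝ) 1, (ENNReal.ofReal a * M.extendedAction Λ (curve μ₀ v t, v.field t) +
          ENNReal.ofReal b * M.extendedAction Λ (curve μ₀ w t, w.field t)) := by
        refine lintegral_mono_ae ?_
        filter_upwards [Lp.coeFn_add (a • v) (b • w), Lp.coeFn_smul a v, Lp.coeFn_smul b w,
          ae_restrict_mem measurableSet_Icc] with t h1 h2 h3 ht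
        have hf : (a • v + b • w : MomentumSpace X).field t = a • v.field t + b • w.field t := by
          ext x y
          simp only [field, h1, h2, h3, Pi.add_apply, Pi.smul_apply, PiLp.add_apply,
            PiLp.smul_apply]
        rw [hf, curve_convex_comb μ₀ v w hab ht,
          ← M.action_eq_extendedAction hΛ (hv.1.1 t ht).1,
          ← M.action_eq_extendedAction hΛ (hw.1.1 t ht).1]
        exact M.action_convex hΛ (hv.1.1 t ht).1 (hw.1.1 t ht).1 ha hb hab _ _
    _ = ENNReal.ofReal a * M.totalAction Λ (curve μ₀ v) v.field +
          ENNReal.ofReal b * M.totalAction Λ (curve μ₀ w) w.field := by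
        rw [lintegral_add_left' ((hvI.aemeasurable_extendedAction M hΛ).const_mul _),
          lintegral_const_mul' _ _ ENNReal.ofReal_ne_top,
          lintegral_const_mul' _ _ ENNReal.ofReal_ne_top, hvI.totalAction_eq M hΛ,
          hwI.totalAction_eq M hΛ]
    _ ≤ ENNReal.ofReal a * c + ENNReal.ofReal b * c := by
        gcongr
        · exact hv.2
        · exact hw.2
    _ = c := by rw [← add_mul, ← ENNReal.ofReal_add ha hb, hab, ENNReal.ofReal_one, one_mul]

/-- Along a subsequence the momenta converge almost everywhere, and the curves converge at every
time; lower semicontinuity of the integrand and Fatou's lemma conclude. -/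
theorem isClosed_momentumAction_le (M : MarkovTriple X) (hΛ : IsAdmissibleMean Λ) (μ₀ μ₁ : X → ℝ)
    {c : ℝ≥0∞} (hc : c ≠ ⊤) : IsClosed {v | M.momentumAction Λ μ₀ μ₁ v ≤ c} := by
  refine IsSeqClosed.isClosed fun v w hv hvw => ?_
  simp only [mem_ofPred_eq, momentumAction_le_iff M μ₀ μ₁ _ hc] at hv ⊢
  have hw : Joins μ₀ μ₁ w := (isClosed_joins μ₀ μ₁).mem_of_tendsto hvw (.of_forall fun n => (hv n).1)
  refine ⟨hw, ?_⟩
  obtain ⟨ns, hns, hae⟩ := (tendstoInMeasure_of_tendsto_Lp hvw).exists_seq_tendsto_ae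
  rw [hw.integralSolution.totalAction_eq M hΛ]
  calc ∫⁻ t in Icc (0 : ℝ) 1, M.extendedAction Λ (curve μ₀ w t, w.field t)
      ≤ ∫⁻ t in Icc (0 : ℝ) 1, liminf (fun n =>
          M.extendedAction Λ (curve μ₀ (v (ns n)) t, (v (ns n)).field t)) atTop := by
        refine lintegral_mono_ae ?_
        filter_upwards [hae, ae_restrict_mem measurableSet_Icc] with t h1 ht
        have hlim : Tendsto (fun n => (curve μ₀ (v (ns n)) t, (v (ns n)).field t)) atTop
            (𝓝 (curve μ₀ w t, w.field t)) := by
          refine Tendsto.prodMk_nhds ?_ ?_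
          · exact ((continuous_curve μ₀ ht).tendsto w).comp (hvw.comp hns.tendsto_atTop)
          · refine tendsto_pi_nhds.2 fun x => tendsto_pi_nhds.2 fun y => ?_
            exact ((EuclideanSpace.proj (𝕜 := ℝ) (x, y)).continuous.tendsto _).comp h1
        have hlsc := (M.lowerSemicontinuous_extendedAction hΛ).lowerSemicontinuousAt
          (curve μ₀ w t, w.field t)
        exact (lowerSemicontinuousAt_iff_le_liminf.1 hlsc).trans
          (liminf_le_liminf_of_le hlim)
    _ ≤ liminf (fun n => ∫⁻ t in Icc (0 : ℝ) 1,
          M.extendedAction Λ (curve μ₀ (v (ns n)) t, (v (ns n)).field t)) atTop :=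
        lintegral_liminf_le' fun n =>
          (hv (ns n)).1.integralSolution.aemeasurable_extendedAction M hΛ
    _ ≤ liminf (fun _ : ℕ => c) atTop := by
        refine liminf_le_liminf (.of_forall fun n => ?_)
        rw [← (hv (ns n)).1.integralSolution.totalAction_eq M hΛ]
        exact (hv (ns n)).2
    _ = c := liminf_const c

theorem exists_norm_le_of_momentumAction_le (M : MarkovTriple X) (hΛ : IsAdmissibleMean Λ)
    (μ₀ μ₁ : X → ℝ) {c : ℝ≥0∞} (hc : c ≠ ⊤) :
    ∃ R : ℝ, ∀ v, M.momentumAction Λ μ₀ μ₁ v ≤ c → ‖v‖ ≤ R := by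
  obtain ⟨C, -, hC⟩ := M.exists_eLpNorm_le hΛ
  refine ⟨((ENNReal.ofReal C * c) ^ (1 / 2 : ℝ)).toReal, fun v hv => ?_⟩
  obtain ⟨h1, h2⟩ := (momentumAction_le_iff M μ₀ μ₁ v hc).1 hv
  rw [Lp.norm_def]
  refine ENNReal.toReal_mono
    (ENNReal.rpow_ne_top_of_nonneg (by norm_num) (ENNReal.mul_ne_top ENNReal.ofReal_ne_top hc)) ?_
  refine (hC _ v.field h1.1).trans ?_
  gcongr

/-- A solution of finite action is represented in the space of momentum fields. -/
theorem exists_momentumAction_eq (M : MarkovTriple X) (hΛ : IsAdmissibleMean Λ)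
    {μ₀ μ₁ : X → ℝ} {μ : ℝ → X → ℝ} {V : ℝ → X → X → ℝ} (h : IntegralSolution μ₀ μ₁ μ V)
    (hfin : M.totalAction Λ μ V ≠ ⊤) :
    ∃ v, M.momentumAction Λ μ₀ μ₁ v = M.totalAction Λ μ V := by
  obtain ⟨C, -, hC⟩ := M.exists_eLpNorm_le hΛ
  have hmem : MemLp (fun t => (WithLp.toLp 2 fun p => V t p.1 p.2 : EuclideanSpace ℝ (X × X))) 2
      (volume.restrict (Icc 0 1)) := by
    refine ⟨?_, (hC μ V h.mem_simplex).trans_lt (ENNReal.rpow_lt_top_of_nonneg (by norm_num)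
      (ENNReal.mul_ne_top ENNReal.ofReal_ne_top hfin))⟩
    refine (PiLp.continuous_toLp 2 _).comp_aestronglyMeasurable ?_
    exact (aemeasurable_pi_iff.2 fun p : X × X =>
      (h.integrableOn p.1 p.2).aestronglyMeasurable.aemeasurable).aestronglyMeasurable
  set v : MomentumSpace X := hmem.toLp _ with hv
  have hfield : ∀ᵐ t ∂(volume.restrict (Icc (0 : ℝ) 1)), v.field t = V t := by
    filter_upwards [hmem.coeFn_toLp] with t ht
    ext x y
    simp only [field, hv, ht]
  have hcurve : ∀ t ∈ Icc (0 : ℝ) 1, curve μ₀ v t = μ t := fun t ht => by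
    ext x
    rw [h.eq_sub_integral t ht x, curve]
    congr 1
    refine intervalIntegral.integral_congr_ae ?_
    filter_upwards [(ae_restrict_iff' measurableSet_Icc).1 hfield] with s hs hs'
    rw [uIoc_of_le ht.1] at hs'
    rw [hs ⟨hs'.1.le, hs'.2.trans ht.2⟩]
  have hj : Joins μ₀ μ₁ v := by
    refine ⟨fun t ht => ?_, ?_⟩
    · rw [hcurve t ht]
      exact h.mem_simplex t ht
    · rw [hcurve 1 (by simp), h.terminal]
  refine ⟨v, ?_⟩
  rw [momentumAction, if_pos hj]
  refine lintegral_congr_ae ?_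
  filter_upwards [hfield, ae_restrict_mem measurableSet_Icc] with t h1 h2
  rw [h1, hcurve t h2]

/-- Between any two probability vectors there is a solution of minimal, finite action. -/
theorem exists_minimiser (M : MarkovTriple X) (hΛ : IsAdmissibleMean Λ) {μ₀ μ₁ : X → ℝ}
    (hμ₀ : μ₀ ∈ stdSimplex ℝ X) (hμ₁ : μ₁ ∈ stdSimplex ℝ X) :
    ∃ μ V, IntegralSolution μ₀ μ₁ μ V ∧ M.totalAction Λ μ V ≠ ⊤ ∧
      ∀ μ' V', IntegralSolution μ₀ μ₁ μ' V' → M.totalAction Λ μ V ≤ M.totalAction Λ μ' V' := by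
  obtain ⟨v, hv⟩ := exists_forall_le_of_sublevel (M.momentumAction Λ μ₀ μ₁)
    (fun c hc => M.isClosed_momentumAction_le hΛ μ₀ μ₁ hc)
    (fun c hc => M.convex_momentumAction_le hΛ μ₀ μ₁ hc)
    (fun c hc => M.exists_norm_le_of_momentumAction_le hΛ μ₀ μ₁ hc)
  obtain ⟨μ, V, h, hfin⟩ := M.exists_totalAction_ne_top hΛ hμ₀ hμ₁
  obtain ⟨w, hw⟩ := M.exists_momentumAction_eq hΛ h hfin
  -- The finite competitor rules out the value `⊤`, so the minimiser really joins the endpoints.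
  have hvfin : M.momentumAction Λ μ₀ μ₁ v ≠ ⊤ := ne_top_of_le_ne_top hfin ((hv w).trans hw.le)
  obtain ⟨hj, -⟩ := (M.momentumAction_le_iff μ₀ μ₁ v hvfin).1 le_rfl
  have he : M.momentumAction Λ μ₀ μ₁ v = M.totalAction Λ (curve μ₀ v) v.field := if_pos hj
  refine ⟨_, _, hj.integralSolution, he ▸ hvfin, fun μ' V' h' => ?_⟩
  by_cases hfin' : M.totalAction Λ μ' V' = ⊤
  · rw [hfin']
    exact le_top
  · obtain ⟨u, hu⟩ := M.exists_momentumAction_eq hΛ h' hfin'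
    rw [← he, ← hu]
    exact hv u

end MarkovTriple

end

section

variable {X : Type*} [Fintype X] {Λ : ℝ → ℝ → ℝ}

/-! ### Push-forward along a retraction -/

section Pushforward

variable [DecidableEq X]

/-- Push-forward of a density. -/
def pushDensity (T : X → X) (μ : X → ℝ) (y : X) : ℝ :=
  ∑ x with T x = y, μ x

/-- Push-forward of a momentum field, with the flow inside fibres removed. -/
def pushMomentum (T : X → X) (V : X → X → ℝ) (y y' : X) : ℝ :=
  if y = y' then 0 else ∑ x with T x = y, ∑ x' with T x' = y', V x x'

/-- The divergence sees only the antisymmetric part of the field, and summed over a fibre paired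
with itself that part cancels; removing the internal flow therefore costs nothing. -/
theorem divergence_pushMomentum (T : X → X) (V : X → X → ℝ) (y : X) :
    divergence (pushMomentum T V) y = pushDensity T (divergence V) y := by
  have h : ∀ y', pushMomentum T V y y' - pushMomentum T V y' y =
      ∑ x with T x = y, ∑ x' with T x' = y', (V x x' - V x' x) := fun y' => by
    simp only [Finset.sum_sub_distrib]
    rw [Finset.sum_comm (f := fun x x' => V x' x)]
    unfold pushMomentum
    by_cases hy : y = y'
    · subst hy
      simp
    · rw [if_neg hy, if_neg (Ne.symm hy)]
  unfold divergence pushDensity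
  simp only [h]
  rw [Finset.sum_comm, Finset.mul_sum]
  exact Finset.sum_congr rfl fun x _ => by rw [Finset.sum_fiberwise]

theorem pushDensity_mem_stdSimplex (T : X → X) {μ : X → ℝ} (hμ : μ ∈ stdSimplex ℝ X) :
    pushDensity T μ ∈ stdSimplex ℝ X := by
  refine ⟨fun y => Finset.sum_nonneg fun x _ => hμ.1 x, ?_⟩
  rw [← hμ.2]
  exact Finset.sum_fiberwise _ _ _

theorem IntegralSolution.push {μ₀ μ₁ : X → ℝ} {μ : ℝ → X → ℝ} {V : ℝ → X → X → ℝ}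
    (h : IntegralSolution μ₀ μ₁ μ V) (T : X → X) :
    IntegralSolution (pushDensity T μ₀) (pushDensity T μ₁) (fun t => pushDensity T (μ t))
      (fun t => pushMomentum T (V t)) where
  integrableOn y y' := by
    unfold pushMomentum
    split_ifs
    · exact integrableOn_zero
    · exact integrable_finsetSum _ fun x _ => integrable_finsetSum _ fun x' _ => h.integrableOn x x'
  mem_simplex t ht := pushDensity_mem_stdSimplex T (h.mem_simplex t ht)
  eq_sub_integral t ht y := by
    simp only [divergence_pushMomentum]
    unfold pushDensity
    rw [intervalIntegral.integral_finsetSum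
      fun x _ => intervalIntegrable_divergence h.integrableOn x (by simp) ht,
      ← Finset.sum_sub_distrib]
    exact Finset.sum_congr rfl fun x _ => h.eq_sub_integral t ht x
  terminal := by simp only [h.terminal]

namespace MarkovTriple.IsRetraction

variable {M : MarkovTriple X} {Y : Set X} {T : X → X}

theorem support_pushDensity_subset (hT : M.IsRetraction Y T) (μ : X → ℝ) :
    Function.support (pushDensity T μ) ⊆ Y := by
  intro y hy
  obtain ⟨x, hx, -⟩ := Finset.exists_ne_zero_of_sum_ne_zero hy
  rw [Finset.mem_filter] at hx
  exact hx.2 ▸ hT.mapsTo x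

theorem pushDensity_eq_self (hT : M.IsRetraction Y T) {μ : X → ℝ}
    (hμ : Function.support μ ⊆ Y) : pushDensity T μ = μ := by
  ext y
  unfold pushDensity
  by_cases hy : y ∈ Y
  · refine (Finset.sum_eq_single_of_mem y (by simp [hT.fixes y hy]) fun x hx hxy => ?_)
    by_contra h
    rw [Finset.mem_filter, hT.fixes x (hμ h)] at hx
    exact hxy hx.2
  · rw [Finset.sum_eq_zero, eq_comm]
    · exact Function.notMem_support.1 fun h => hy (hμ h)
    · intro x hx
      rw [Finset.mem_filter] at hx
      exact absurd (hx.2 ▸ hT.mapsTo x) hy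

/-- The rate inequality of the retraction enters here, integrated against the density over the fibre
of `y`. For `y'` outside `Y` the fibre is empty. -/
theorem sum_fibre_le (hT : M.IsRetraction Y T) {μ : X → ℝ} (hμ : 0 ≤ μ) {y y' : X}
    (hyy : y ≠ y') :
    ∑ x with T x = y, ∑ x' with T x' = y', μ x * M.Q x x' ≤ pushDensity T μ y * M.Q y y' := by
  unfold pushDensity
  rw [Finset.sum_mul]
  refine Finset.sum_le_sum fun x hx => ?_
  rw [Finset.mem_filter] at hx
  rw [← Finset.mul_sum]
  by_cases hy' : y' ∈ Y
  · exact mul_le_mul_of_nonneg_left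
      (hT.rate_le y (hx.2 ▸ hT.mapsTo x) y' hy' hyy x hx.2) (hμ x)
  · rw [Finset.sum_eq_zero, mul_zero]
    · exact mul_nonneg (hμ x) (M.Q_nonneg _ _)
    · intro z hz
      rw [Finset.mem_filter] at hz
      exact absurd (hz.2 ▸ hT.mapsTo z) hy'

/-- Retractions do not increase the action. -/
theorem action_push_le (hT : M.IsRetraction Y T) (hΛ : IsAdmissibleMean Λ) {μ : X → ℝ}
    (hμ : 0 ≤ μ) (V : X → X → ℝ) :
    M.action Λ (pushDensity T μ) (pushMomentum T V) ≤ M.action Λ μ V := by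
  unfold action
  gcongr 2⁻¹ * ?_
  have hpush : 0 ≤ pushDensity T μ := fun y => Finset.sum_nonneg fun x _ => hμ x
  have hedge : ∀ y y', edgeAction Λ (pushDensity T μ y * M.Q y y') (pushDensity T μ y' * M.Q y' y)
      (pushMomentum T V y y') ≤ ∑ x with T x = y, ∑ x' with T x' = y',
        edgeAction Λ (μ x * M.Q x x') (μ x' * M.Q x' x) (V x x') := fun y y' => by
    unfold pushMomentum
    split_ifs with hyy
    · rw [hΛ.edgeAction_zero (mul_nonneg (hpush y) (M.Q_nonneg _ _))
        (mul_nonneg (hpush y') (M.Q_nonneg _ _))]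
      exact zero_le
    · simp only [← Finset.sum_product']
      -- Subadditivity over pairs of points in the two fibres; the two remaining goals are the flux
      -- bounds from `y` to `y'` and back.
      refine hΛ.edgeAction_sum_le _ (fun p : X × X => μ p.1 * M.Q p.1 p.2)
        (fun p => μ p.2 * M.Q p.2 p.1) (fun p => V p.1 p.2)
        (fun p => mul_nonneg (hμ _) (M.Q_nonneg _ _)) (fun p => mul_nonneg (hμ _) (M.Q_nonneg _ _))
        ?_ ?_
      · rw [Finset.sum_product]
        exact hT.sum_fibre_le hμ hyy
      · rw [Finset.sum_product_right]
        exact hT.sum_fibre_le hμ (Ne.symm hyy)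
  calc _ ≤ ∑ y, ∑ y', ∑ x with T x = y, ∑ x' with T x' = y',
        edgeAction Λ (μ x * M.Q x x') (μ x' * M.Q x' x) (V x x') :=
        Finset.sum_le_sum fun y _ => Finset.sum_le_sum fun y' _ => hedge y y'
    _ = _ := by
        -- The products of fibres partition the set of all edges.
        rw [← Finset.sum_fiberwise Finset.univ T (fun x => ∑ x', edgeAction Λ (μ x * M.Q x x')
          (μ x' * M.Q x' x) (V x x'))]
        refine Finset.sum_congr rfl fun y _ => ?_
        rw [Finset.sum_comm]
        exact Finset.sum_congr rfl fun x _ => by rw [Finset.sum_fiberwise]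

end MarkovTriple.IsRetraction

end Pushforward

/-! ### Transport cost, triangle inequality and constant speed -/

namespace MarkovTriple

/-- The least action, as a real number; the square of the transport distance. -/
noncomputable def cost (M : MarkovTriple X) (Λ : ℝ → ℝ → ℝ) (a b : X → ℝ) : ℝ :=
  (⨅ (μ : ℝ → X → ℝ) (V : ℝ → X → X → ℝ) (_ : IntegralSolution a b μ V),
    M.totalAction Λ μ V).toReal

variable {M : MarkovTriple X}

theorem cost_nonneg (a b : X → ℝ) : 0 ≤ M.cost Λ a b := ENNReal.toReal_nonneg

theorem ofReal_cost_le (hΛ : IsAdmissibleMean Λ) {a b : X → ℝ} (ha : a ∈ stdSimplex ℝ X)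
    (hb : b ∈ stdSimplex ℝ X) {μ : ℝ → X → ℝ} {V : ℝ → X → X → ℝ}
    (h : IntegralSolution a b μ V) : ENNReal.ofReal (M.cost Λ a b) ≤ M.totalAction Λ μ V := by
  obtain ⟨μ', V', h', hfin, -⟩ := M.exists_minimiser hΛ ha hb
  rw [cost, ENNReal.ofReal_toReal]
  · exact iInf_le_of_le μ (iInf_le_of_le V (iInf_le _ h))
  · exact ne_top_of_le_ne_top hfin (iInf_le_of_le μ' (iInf_le_of_le V' (iInf_le _ h')))

theorem exists_totalAction_eq_cost (hΛ : IsAdmissibleMean Λ) {a b : X → ℝ}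
    (ha : a ∈ stdSimplex ℝ X) (hb : b ∈ stdSimplex ℝ X) :
    ∃ μ V, IntegralSolution a b μ V ∧ M.totalAction Λ μ V = ENNReal.ofReal (M.cost Λ a b) := by
  obtain ⟨μ, V, h, hfin, hmin⟩ := M.exists_minimiser hΛ ha hb
  refine ⟨μ, V, h, le_antisymm ?_ (ofReal_cost_le hΛ ha hb h)⟩
  rw [cost, ENNReal.ofReal_toReal]
  · exact le_iInf fun μ' => le_iInf fun V' => le_iInf fun h' => hmin μ' V' h'
  · exact ne_top_of_le_ne_top hfin (iInf_le_of_le μ (iInf_le_of_le V (iInf_le _ h)))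

theorem W_eq_ofReal_sqrt_cost (hΛ : IsAdmissibleMean Λ) {a b : X → ℝ} (ha : a ∈ stdSimplex ℝ X)
    (hb : b ∈ stdSimplex ℝ X) : M.W Λ a b = ENNReal.ofReal (√(M.cost Λ a b)) := by
  have e : ENNReal.ofReal (√(M.cost Λ a b)) = ENNReal.ofReal (M.cost Λ a b) ^ (1 / 2 : ℝ) := by
    rw [Real.sqrt_eq_rpow, ENNReal.ofReal_rpow_of_nonneg (cost_nonneg a b) (by norm_num)]
  rw [e]
  apply le_antisymm
  · obtain ⟨μ, V, h, he⟩ := exists_totalAction_eq_cost (M := M) hΛ ha hb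
    rw [← he]
    exact iInf_le_of_le μ (iInf_le_of_le V (iInf_le _ (continuityEquation_iff.2 h)))
  · refine le_iInf fun μ => le_iInf fun V => le_iInf fun h => ?_
    exact ENNReal.rpow_le_rpow (ofReal_cost_le hΛ ha hb (continuityEquation_iff.1 h)) (by norm_num)

/-- The rescaled restriction is a competitor. The unordered interval also allows `t < s`, where time
is reversed. -/
theorem ofReal_cost_restrict_le (hΛ : IsAdmissibleMean Λ) {a b : X → ℝ} {μ : ℝ → X → ℝ}
    {V : ℝ → X → X → ℝ} (h : IntegralSolution a b μ V) {s t : ℝ} (hs : s ∈ Icc (0 : ℝ) 1)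
    (ht : t ∈ Icc (0 : ℝ) 1) : ENNReal.ofReal (M.cost Λ (μ s) (μ t)) ≤
      ENNReal.ofReal |t - s| * ∫⁻ r in uIcc s t, M.action Λ (μ r) (V r) := by
  refine (ofReal_cost_le hΛ (h.mem_simplex s hs) (h.mem_simplex t ht)
    (h.restrict hs ht)).trans ?_
  refine M.lintegral_action_affine_le hΛ V measurableSet_Icc (t - s) s (fun r hr => ?_)
    fun r hr => (h.mem_simplex r (uIcc_subset_Icc hs ht hr)).1
  have := (convex_uIcc s t).add_smul_sub_mem left_mem_uIcc right_mem_uIcc hr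
  simpa [mul_comm] using this

theorem cost_comm (hΛ : IsAdmissibleMean Λ) {a b : X → ℝ} (ha : a ∈ stdSimplex ℝ X)
    (hb : b ∈ stdSimplex ℝ X) : M.cost Λ a b = M.cost Λ b a := by
  have key : ∀ {a b : X → ℝ}, a ∈ stdSimplex ℝ X → b ∈ stdSimplex ℝ X →
      M.cost Λ b a ≤ M.cost Λ a b := fun {a b} ha hb => by
    obtain ⟨μ, V, h, he⟩ := exists_totalAction_eq_cost (M := M) hΛ ha hb
    have h1 := ofReal_cost_restrict_le (M := M) hΛ h (s := 1) (t := 0) (by simp) (by simp)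
    rw [h.initial, h.terminal, uIcc_of_ge zero_le_one] at h1
    change _ ≤ _ * M.totalAction Λ μ V at h1
    rw [he] at h1
    simpa [ENNReal.ofReal_le_ofReal_iff (cost_nonneg a b)] using h1
  exact le_antisymm (key hb ha) (key ha hb)

/-- Running through the two optimal curves in times `l` and `1 - l` gives a competitor. -/
theorem cost_le_div_add_div (hΛ : IsAdmissibleMean Λ) {a b c : X → ℝ} (ha : a ∈ stdSimplex ℝ X)
    (hb : b ∈ stdSimplex ℝ X) (hc : c ∈ stdSimplex ℝ X) {l : ℝ} (hl0 : 0 < l) (hl1 : l < 1) :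
    M.cost Λ a c ≤ l⁻¹ * M.cost Λ a b + (1 - l)⁻¹ * M.cost Λ b c := by
  obtain ⟨μ, V, h, he⟩ := exists_totalAction_eq_cost (M := M) hΛ ha hb
  obtain ⟨ν, U, h', he'⟩ := exists_totalAction_eq_cost (M := M) hΛ hb hc
  obtain ⟨ρ, R, hρ, hle⟩ := h.exists_glue M hΛ h' hl0 hl1
  have hl : 0 ≤ (1 - l)⁻¹ := inv_nonneg.2 (by linarith)
  have h1 := (ofReal_cost_le (M := M) hΛ ha hc hρ).trans hle
  rw [he, he', ← ENNReal.ofReal_mul (by positivity), ← ENNReal.ofReal_mul hl,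
    ← ENNReal.ofReal_add (mul_nonneg (by positivity) (cost_nonneg _ _))
      (mul_nonneg hl (cost_nonneg _ _))] at h1
  exact (ENNReal.ofReal_le_ofReal_iff (add_nonneg (mul_nonneg (by positivity) (cost_nonneg _ _))
      (mul_nonneg hl (cost_nonneg _ _)))).1 h1

theorem sqrt_cost_triangle (hΛ : IsAdmissibleMean Λ) {a b c : X → ℝ} (ha : a ∈ stdSimplex ℝ X)
    (hb : b ∈ stdSimplex ℝ X) (hc : c ∈ stdSimplex ℝ X) :
    √(M.cost Λ a c) ≤ √(M.cost Λ a b) + √(M.cost Λ b c) := by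
  set p := √(M.cost Λ a b) with hp
  set q := √(M.cost Λ b c) with hq
  have hp0 : 0 ≤ p := Real.sqrt_nonneg _
  have hq0 : 0 ≤ q := Real.sqrt_nonneg _
  refine le_of_forall_pos_le_add fun ε hε => ?_
  -- The optimal split of time is `p / (p + q)`; the shift by `ε / 2` keeps it strictly between 0
  -- and 1 when a cost vanishes.
  set p' := p + ε / 2 with hp'
  set q' := q + ε / 2 with hq'
  have hp'0 : 0 < p' := by positivity
  have hq'0 : 0 < q' := by positivity
  have h := cost_le_div_add_div (M := M) hΛ ha hb hc (l := p' / (p' + q')) (by positivity)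
    (by rw [div_lt_one (by positivity)]; linarith)
  have e : 1 - p' / (p' + q') = q' / (p' + q') := by
    field_simp
    ring
  rw [e, inv_div, inv_div, ← Real.sq_sqrt (cost_nonneg a b), ← Real.sq_sqrt (cost_nonneg b c),
    ← hp, ← hq] at h
  rw [show p + q + ε = p' + q' by simp only [hp', hq']; ring]
  refine Real.sqrt_le_left (by positivity) |>.2 (h.trans ?_)
  calc (p' + q') / p' * p ^ 2 + (p' + q') / q' * q ^ 2
      ≤ (p' + q') / p' * p' ^ 2 + (p' + q') / q' * q' ^ 2 := by
        gcongr <;> linarith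
    _ = (p' + q') ^ 2 := by
        field_simp

end MarkovTriple

/-- Equality in the Cauchy-Schwarz inequality for a curve cut into three pieces. -/
theorem eq_mul_of_minimal_pieces {d p q r e₁ e₂ e₃ α β γ : ℝ} (hd : 0 ≤ d) (hp : 0 ≤ p) (hq : 0 ≤ q)
    (hr : 0 ≤ r) (he₁ : 0 ≤ e₁) (he₂ : 0 ≤ e₂) (he₃ : 0 ≤ e₃) (hα : 0 ≤ α) (hβ : 0 ≤ β)
    (hγ : 0 ≤ γ) (hsum : α + β + γ = 1) (he : e₁ + e₂ + e₃ ≤ d ^ 2) (h₁ : p ^ 2 ≤ α * e₁)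
    (h₂ : q ^ 2 ≤ β * e₂) (h₃ : r ^ 2 ≤ γ * e₃) (hdpqr : d ≤ p + q + r) : q = β * d := by
  -- Summed over the pieces, these bounds give `2 * (p + q + r) * d ≤ 2 * d ^ 2`, while `d ≤ p + q +
  -- r` gives the reverse; hence each is an equality.
  have amgm : ∀ {x e w : ℝ}, 0 ≤ x → 0 ≤ e → 0 ≤ w → x ^ 2 ≤ w * e → 2 * x * d ≤ e + w * d ^ 2 :=
    fun {x e w} hx he hw h => by
      refine abs_le_of_sq_le_sq' ?_ (by positivity) |>.2
      nlinarith [sq_nonneg (e - w * d ^ 2), mul_le_mul_of_nonneg_right h (sq_nonneg d)]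
  have a₁ := amgm hp he₁ hα h₁
  have a₂ := amgm hq he₂ hβ h₂
  have a₃ := amgm hr he₃ hγ h₃
  rcases hd.eq_or_lt with rfl | hd
  · have : e₂ = 0 := by nlinarith
    rw [this, mul_zero] at h₂
    nlinarith [pow_eq_zero_iff two_ne_zero |>.1 (le_antisymm h₂ (sq_nonneg q))]
  · have hge : e₂ + β * d ^ 2 ≤ 2 * q * d := by nlinarith
    have heq : 2 * q * d = e₂ + β * d ^ 2 := le_antisymm a₂ hge
    -- The equality case of the arithmetic-geometric mean inequality for `e₂` and `β * d ^ 2`.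
    have hz : (e₂ - β * d ^ 2) ^ 2 ≤ 0 := by
      have : (2 * q * d) ^ 2 ≤ 4 * (β * e₂) * d ^ 2 := by
        nlinarith [mul_le_mul_of_nonneg_right h₂ (sq_nonneg d)]
      rw [heq] at this
      nlinarith
    have hz' := pow_eq_zero_iff two_ne_zero |>.1 (le_antisymm hz (sq_nonneg _))
    have : 2 * d * (q - β * d) = 0 := by linarith
    rcases mul_eq_zero.1 this with h | h <;> linarith

namespace MarkovTriple

/-- Minimisers of the action have constant speed. -/
theorem sqrt_cost_eq_of_minimal {M : MarkovTriple X} (hΛ : IsAdmissibleMean Λ) {a b : X → ℝ}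
    {μ : ℝ → X → ℝ} {V : ℝ → X → X → ℝ} (h : IntegralSolution a b μ V)
    (hmin : M.totalAction Λ μ V = ENNReal.ofReal (M.cost Λ a b)) {s t : ℝ}
    (hs : s ∈ Icc (0 : ℝ) 1) (ht : t ∈ Icc (0 : ℝ) 1) (hst : s ≤ t) :
    √(M.cost Λ (μ s) (μ t)) = (t - s) * √(M.cost Λ a b) := by
  have h0 : (0 : ℝ) ∈ Icc (0 : ℝ) 1 := by simp
  have h1 : (1 : ℝ) ∈ Icc (0 : ℝ) 1 := by simp
  set E : ℝ → ℝ → ℝ≥0∞ := fun u v => ∫⁻ r in Ioc u v, M.action Λ (μ r) (V r) with hE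
  have hsplit : E 0 s + E s t + E t 1 = ENNReal.ofReal (M.cost Λ a b) := by
    rw [← hmin, totalAction,
      setLIntegral_congr (Ioc_ae_eq_Icc (μ := volume) (a := (0 : ℝ)) (b := 1)).symm,
      ← Ioc_union_Ioc_eq_Ioc ht.1 ht.2, lintegral_union measurableSet_Ioc
        (Ioc_disjoint_Ioc_of_le le_rfl), ← Ioc_union_Ioc_eq_Ioc hs.1 hst,
      lintegral_union measurableSet_Ioc (Ioc_disjoint_Ioc_of_le le_rfl)]
  have hfin : E 0 s + E s t + E t 1 ≠ ⊤ := hsplit ▸ ENNReal.ofReal_ne_top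
  simp only [ENNReal.add_ne_top] at hfin
  obtain ⟨⟨f₁, f₂⟩, f₃⟩ := hfin
  have hpiece : ∀ {u v : ℝ}, u ∈ Icc (0 : ℝ) 1 → v ∈ Icc (0 : ℝ) 1 → u ≤ v → E u v ≠ ⊤ →
      √(M.cost Λ (μ u) (μ v)) ^ 2 ≤ (v - u) * (E u v).toReal := fun {u v} hu hv huv hf => by
    have := ofReal_cost_restrict_le (M := M) hΛ h hu hv
    rw [uIcc_of_le huv, setLIntegral_congr (Ioc_ae_eq_Icc (μ := volume)).symm,
      abs_of_nonneg (sub_nonneg.2 huv)] at this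
    change _ ≤ _ * E u v at this
    rw [Real.sq_sqrt (cost_nonneg _ _)]
    have h2 := ENNReal.toReal_mono (ENNReal.mul_ne_top ENNReal.ofReal_ne_top hf) this
    rwa [ENNReal.toReal_ofReal (cost_nonneg _ _), ENNReal.toReal_mul,
      ENNReal.toReal_ofReal (sub_nonneg.2 huv)] at h2
  have htri : √(M.cost Λ a b) ≤
      √(M.cost Λ (μ 0) (μ s)) + √(M.cost Λ (μ s) (μ t)) + √(M.cost Λ (μ t) (μ 1)) := by
    have m := fun {u : ℝ} (hu : u ∈ Icc (0 : ℝ) 1) => h.mem_simplex u hu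
    have t1 := sqrt_cost_triangle (M := M) hΛ (m h0) (m hs) (m ht)
    have t2 := sqrt_cost_triangle (M := M) hΛ (m h0) (m ht) (m h1)
    rw [← h.initial, ← h.terminal]
    linarith
  refine eq_mul_of_minimal_pieces (Real.sqrt_nonneg _) (Real.sqrt_nonneg _) (Real.sqrt_nonneg _)
    (Real.sqrt_nonneg _) ENNReal.toReal_nonneg ENNReal.toReal_nonneg ENNReal.toReal_nonneg
    (sub_nonneg.2 hs.1) (sub_nonneg.2 hst) (sub_nonneg.2 ht.2) (by ring) ?_ (hpiece h0 hs hs.1 f₁)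
    (hpiece hs ht hst f₂) (hpiece ht h1 ht.2 f₃) htri
  rw [Real.sq_sqrt (cost_nonneg _ _), ← ENNReal.toReal_add f₁ f₂,
    ← ENNReal.toReal_add (ENNReal.add_ne_top.2 ⟨f₁, f₂⟩) f₃, hsplit,
    ENNReal.toReal_ofReal (cost_nonneg _ _)]

theorem isMinimisingGeodesic_of_minimal {M : MarkovTriple X} (hΛ : IsAdmissibleMean Λ)
    {a b : X → ℝ} (ha : a ∈ stdSimplex ℝ X) (hb : b ∈ stdSimplex ℝ X)
    {μ : ℝ → X → ℝ} {V : ℝ → X → X → ℝ} (h : IntegralSolution a b μ V)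
    (hmin : M.totalAction Λ μ V = ENNReal.ofReal (M.cost Λ a b)) :
    M.IsMinimisingGeodesic Λ a b μ where
  finite := by
    rw [W_eq_ofReal_sqrt_cost hΛ ha hb]
    exact ENNReal.ofReal_ne_top
  minimal := by
    refine ⟨V, continuityEquation_iff.2 h, ?_⟩
    rw [W_eq_ofReal_sqrt_cost hΛ ha hb, hmin, Real.sqrt_eq_rpow,
      ENNReal.ofReal_rpow_of_nonneg (cost_nonneg a b) (by norm_num)]
  constant_speed s hs t ht := by
    rw [W_eq_ofReal_sqrt_cost hΛ ha hb,
      W_eq_ofReal_sqrt_cost hΛ (h.mem_simplex s hs) (h.mem_simplex t ht),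
      ← ENNReal.ofReal_mul (abs_nonneg _)]
    congr 1
    rcases le_total s t with hst | hst
    · rw [sqrt_cost_eq_of_minimal hΛ h hmin hs ht hst, abs_of_nonneg (sub_nonneg.2 hst)]
    · rw [cost_comm hΛ (h.mem_simplex s hs) (h.mem_simplex t ht),
        sqrt_cost_eq_of_minimal hΛ h hmin ht hs hst, abs_sub_comm,
        abs_of_nonneg (sub_nonneg.2 hst)]

end MarkovTriple

end

end DiscreteTransport

theorem theorem4p6 {X : Type*} [Fintype X] [DecidableEq X]
    (M : DiscreteTransport.MarkovTriple X)
    (Λ : ℝ → ℝ → ℝ) (hΛ : DiscreteTransport.IsAdmissibleMean Λ)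
    (Y : Set X) (hY : M.HasRetractionProperty Y)
    (μ₀ μ₁ : X → ℝ) (hμ₀ : μ₀ ∈ stdSimplex ℝ X) (hμ₁ : μ₁ ∈ stdSimplex ℝ X)
    (hs₀ : Function.support μ₀ ⊆ Y) (hs₁ : Function.support μ₁ ⊆ Y) :
    ∃ μ : ℝ → X → ℝ, M.IsMinimisingGeodesic Λ μ₀ μ₁ μ ∧
      ∀ t ∈ Set.Icc (0 : ℝ) 1, Function.support (μ t) ⊆ Y := by
  obtain ⟨-, T, hT⟩ := hY
  obtain ⟨μ, V, h, he⟩ :=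
    DiscreteTransport.MarkovTriple.exists_totalAction_eq_cost (M := M) hΛ hμ₀ hμ₁
  have hpush := h.push T
  -- The endpoints are supported in `Y`, so the pushed curve is a competitor for the original
  -- problem.
  rw [hT.pushDensity_eq_self hs₀, hT.pushDensity_eq_self hs₁] at hpush
  refine ⟨_, DiscreteTransport.MarkovTriple.isMinimisingGeodesic_of_minimal hΛ hμ₀ hμ₁ hpush
    (le_antisymm ?_ (DiscreteTransport.MarkovTriple.ofReal_cost_le hΛ hμ₀ hμ₁ hpush)),
    fun t _ => hT.support_pushDensity_subset (μ t)⟩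
  rw [← he]
  exact setLIntegral_mono' measurableSet_Icc fun t ht =>
    hT.action_push_le hΛ (h.mem_simplex t ht).1 (V t)
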